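/- Work over $\mathbb{C}$. A trilinear rational map $\phi:\mathbb{P}^1\times\mathbb{P}^1\times\mathbb{P}^1\dashrightarrow\mathbb{P}^3$ is given by four trilinear forms $f_0,\dots,f_3$ in $(s_0,s_1),(t_0,t_1),(u_0,u_1)$ without a common factor, so it is a point of $\mathbb{P}^{31}$. It is birational of type $(d_1,d_2,d_3)$ if it has an inverse rational map $((\sigma_0:\sigma_1),(\tau_0:\tau_1),(\upsilon_0:\upsilon_1))$ whose components are given by pairs of coprime homogeneous polynomials in four variables, of degrees $d_1$, $d_2$, $d_3$ respectively. Let $\mathrm{Bir}_{(1,1,2)}\subset\mathbb{P}^{31}$ be the set of trilinear birational maps of type $(1,1,2)$. The parametric line congruences $S,T,U$ of $\phi$ are the Zariski closures, in the Klein quadric of lines of $\mathbb{P}^3$ (in $\mathbb{P}^5$, by Plücker coordinates), of the sets of $s$-lines, $t$-lines and $u$-lines, i.e. of the lines that are images under $\phi$ of the curves on which the other two factors are fixed. Varieties are irreducible. A variety $V\subset\mathbb{P}^3$ is focal for a family $X$ of lines if it meets every line of $X$ and no variety properly contained in $V$ does. A congruence is quadratic if it has a focal plane conic and a focal line that meets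 this conic; it is degenerate if it has exactly one focal point. Proposition. A general trilinear birational map $\phi$ of type $(1,1,2)$, that is, every $\phi\in G\cap \mathrm{Bir}_{(1,1,2)}$ for some Zariski open $G\subset\mathbb{P}^{31}$ such that $G\cap \mathrm{Bir}_{(1,1,2)}$ is nonempty and Zariski dense in $\mathrm{Bir}_{(1,1,2)}$, has the following property. There are distinct lines $a,b\subset\mathbb{P}^3$ and a smooth plane conic $c\subset\mathbb{P}^3$ such that $a$ and $b$ are coplanar, each of $a\cap c$ and $b\cap c$ is a single point, and: 1. $S$ is quadratic, and its focal curves are exactly $a$ and $c$. 2. $T$ is quadratic, and its focal curves are exactly $b$ and $c$. 3. $U$ is degenerate, and its only focal point is the point $O$ with $a\cap b=\{O\}$. -/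

import Mathlib

open scoped LinearAlgebra.Projectivization

noncomputable section

namespace TrilinearCongruence

open MvPolynomial

/-! ### Projective spaces and the Zariski topology -/

/-- Projective space over `ℂ` with homogeneous coordinates indexed by `ι`. -/
abbrev PSpace (ι : Type) : Type := ℙ ℂ (ι → ℂ)

/-- Zariski closed subsets of projective space: common zero loci of homogeneous polynomials. -/
def IsZariskiClosed {ι : Type} (Z : Set (PSpace ι)) : Prop :=
  ∃ E : Set (MvPolynomial ι ℂ), (∀ p ∈ E, ∃ d : ℕ, p.IsHomogeneous d) ∧
    Z = {x | ∀ p ∈ E, eval x.rep p = 0}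

/-- Zariski open subsets of projective space. -/
def IsZariskiOpen {ι : Type} (U : Set (PSpace ι)) : Prop := IsZariskiClosed Uᶜ

/-- The Zariski closure: the intersection of all Zariski closed sets containing `A`. -/
def zariskiClosure {ι : Type} (A : Set (PSpace ι)) : Set (PSpace ι) :=
  ⋂₀ {Z | IsZariskiClosed Z ∧ A ⊆ Z}

/-- A (projective) variety: a nonempty irreducible Zariski closed set. -/
def IsVariety {ι : Type} (V : Set (PSpace ι)) : Prop :=
  IsZariskiClosed V ∧ V.Nonempty ∧
    ∀ Z₁ Z₂ : Set (PSpace ι), IsZariskiClosed Z₁ → IsZariskiClosed Z₂ →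
      V ⊆ Z₁ ∪ Z₂ → V ⊆ Z₁ ∨ V ⊆ Z₂

/-- A curve: a variety of dimension one. That is, it is not a point, and every variety properly
contained in it is a point, so the longest chains of varieties in it have length one. -/
def IsCurve {ι : Type} (V : Set (PSpace ι)) : Prop :=
  IsVariety V ∧ V.Nontrivial ∧ ∀ W, IsVariety W → W ⊂ V → W.Subsingleton

/-! ### Lines, planes and plane conics in three-space -/

/-- Complex projective three-space. -/
abbrev P3 : Type := PSpace (Fin 4)

/-- The projective linear subspace attached to a linear subspace. -/
def linearSet (W : Submodule ℂ (Fin 4 → ℂ)) : Set P3 := {p | p.rep ∈ W}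

/-- Lines in three-space. -/
def IsLine (a : Set P3) : Prop :=
  ∃ W : Submodule ℂ (Fin 4 → ℂ), Module.finrank ℂ W = 2 ∧ a = linearSet W

/-- Planes in three-space. -/
def IsPlane (a : Set P3) : Prop :=
  ∃ W : Submodule ℂ (Fin 4 → ℂ), Module.finrank ℂ W = 3 ∧ a = linearSet W

/-- (Smooth, equivalently irreducible) plane conics: the zeros, in the plane given by a
three-dimensional linear subspace `W`, of a nondegenerate quadratic form on `W`. -/
def IsPlaneConic (c : Set P3) : Prop :=
  ∃ (W : Submodule ℂ (Fin 4 → ℂ)) (q : QuadraticForm ℂ W), Module.finrank ℂ W = 3 ∧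
    (∀ x : W, (∀ y : W, QuadraticMap.polar q x y = 0) → x = 0) ∧
    c = {p | ∃ h : p.rep ∈ W, q ⟨p.rep, h⟩ = 0}

/-! ### Plücker coordinates, line congruences and focal varieties -/

/-- The space containing the Klein quadric, with the homogeneous coordinates
`(c₀₁ : c₀₂ : c₀₃ : c₂₃ : c₃₁ : c₁₂)`. -/
abbrev P5 : Type := PSpace (Fin 6)

/-- The Plücker coordinates of the exterior product of two vectors. -/
def plucker (a b : Fin 4 → ℂ) : Fin 6 → ℂ :=
  ![a 0 * b 1 - a 1 * b 0, a 0 * b 2 - a 2 * b 0, a 0 * b 3 - a 3 * b 0,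
    a 2 * b 3 - a 3 * b 2, a 3 * b 1 - a 1 * b 3, a 1 * b 2 - a 2 * b 1]

/-- The vanishing of the four coordinates of the exterior product of `x` with the bivector whose
coordinates are `w`. -/
def WedgeVanishes (w : Fin 6 → ℂ) (x : Fin 4 → ℂ) : Prop :=
  x 0 * w 5 - x 1 * w 1 + x 2 * w 0 = 0 ∧
  x 0 * w 4 + x 1 * w 2 - x 3 * w 0 = 0 ∧
  x 0 * w 3 - x 2 * w 2 + x 3 * w 1 = 0 ∧
  x 1 * w 3 + x 2 * w 4 + x 3 * w 5 = 0

/-- Consistency check: for independent `a` and `b`, the vectors whose exterior product with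
`a ∧ b` vanishes are exactly those in the span of `a` and `b`. -/
theorem wedgeVanishes_plucker_iff (a b x : Fin 4 → ℂ) (h : plucker a b ≠ 0) :
    WedgeVanishes (plucker a b) x ↔ x ∈ Submodule.span ℂ {a, b} := by
  rw [Submodule.mem_span_pair]
  constructor
  · rintro ⟨h1, h2, h3, h4⟩
    simp only [plucker, Matrix.cons_val] at h1 h2 h3 h4
    have key : ∀ i j : Fin 4, a i * b j - a j * b i ≠ 0 →
        (∀ k, (a i * b j - a j * b i) * x k =
          (x i * b j - x j * b i) * a k + (a i * x j - a j * x i) * b k) →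
        ∃ r s : ℂ, r • a + s • b = x := by
      intro i j hne hk
      refine ⟨(x i * b j - x j * b i) / (a i * b j - a j * b i),
        (a i * x j - a j * x i) / (a i * b j - a j * b i), ?_⟩
      funext k
      have := hk k
      simp only [Pi.add_apply, Pi.smul_apply, smul_eq_mul]
      apply mul_left_cancel₀ hne
      rw [this, mul_add]
      congr 1 <;> field_simp
    by_contra hcon
    apply h
    have z : ∀ i j : Fin 4, (∀ k, (a i * b j - a j * b i) * x k =
          (x i * b j - x j * b i) * a k + (a i * x j - a j * x i) * b k) →
        a i * b j - a j * b i = 0 := by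
      intro i j hk
      by_contra hne
      exact hcon (key i j hne hk)
    have e01 := z 0 1 (by intro k; fin_cases k <;> simp <;> grind)
    have e02 := z 0 2 (by intro k; fin_cases k <;> simp <;> grind)
    have e03 := z 0 3 (by intro k; fin_cases k <;> simp <;> grind)
    have e23 := z 2 3 (by intro k; fin_cases k <;> simp <;> grind)
    have e31 := z 3 1 (by intro k; fin_cases k <;> simp <;> grind)
    have e12 := z 1 2 (by intro k; fin_cases k <;> simp <;> grind)
    simp only [plucker, e01, e02, e03, e23, e31, e12]
    funext k
    fin_cases k <;> rfl
  · rintro ⟨r, s, rfl⟩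
    simp only [WedgeVanishes, plucker, Matrix.cons_val, Pi.add_apply, Pi.smul_apply, smul_eq_mul]
    refine ⟨?_, ?_, ?_, ?_⟩ <;> ring

/-- The points of the line in three-space with Plücker coordinates `w`. -/
def linePoints (w : P5) : Set P3 := {p | WedgeVanishes w.rep p.rep}

/-- `V` meets every line of the family `X`. -/
def MeetsAll (V : Set P3) (X : Set P5) : Prop := ∀ w ∈ X, (V ∩ linePoints w).Nonempty

/-- `V` is a focal variety of the line congruence `X`: it meets every line of `X`, and it is
minimal among varieties with this property. -/
def IsFocal (V : Set P3) (X : Set P5) : Prop :=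
  IsVariety V ∧ MeetsAll V X ∧ ∀ W, IsVariety W → W ⊆ V → MeetsAll W X → W = V

/-- The focal curves of a line congruence. -/
def focalCurves (X : Set P5) : Set (Set P3) := {V | IsCurve V ∧ IsFocal V X}

/-- The focal points of a line congruence. -/
def focalPoints (X : Set P5) : Set P3 := {p | IsFocal {p} X}

/-- A line congruence is quadratic if it has a focal plane conic and a focal line that meets the
conic. -/
def IsQuadratic (X : Set P5) : Prop :=
  ∃ c l : Set P3, IsPlaneConic c ∧ IsLine l ∧ IsFocal c X ∧ IsFocal l X ∧ (l ∩ c).Nonempty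

/-- A line congruence is degenerate if it has a single focal point. -/
def IsDegenerate (X : Set P5) : Prop := ∃ p, focalPoints X = {p}

/-! ### Trilinear birational maps -/

/-- Coefficients of a quadruple of trilinear forms: `f (i, j, k, l)` is the coefficient of
`s_j * t_k * u_l` in `f_i`. -/
abbrev Coeffs : Type := Fin 4 × Fin 2 × Fin 2 × Fin 2 → ℂ

/-- The projective space of dimension 31 that parametrizes quadruples of trilinear forms, not all
zero, up to a common scalar. -/
abbrev TrilinearSpace : Type := PSpace (Fin 4 × Fin 2 × Fin 2 × Fin 2)

/-- The trilinear forms `f_i`. The variables `(0, j)`, `(1, j)`, `(2, j)` stand for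
`s_j`, `t_j`, `u_j`. -/
def form (f : Coeffs) (i : Fin 4) : MvPolynomial (Fin 3 × Fin 2) ℂ :=
  ∑ j : Fin 2, ∑ k : Fin 2, ∑ l : Fin 2, C (f (i, j, k, l)) * X (0, j) * X (1, k) * X (2, l)

/-- The value of the quadruple of forms at homogeneous coordinates `y 0`, `y 1`, `y 2` of the
three factors. -/
def evalAt (f : Coeffs) (y : Fin 3 → Fin 2 → ℂ) : Fin 4 → ℂ :=
  fun i => eval (fun v => y v.1 v.2) (form f i)

/-- The forms `f_i` have no common factor. -/
def NoCommonFactor (f : Coeffs) : Prop :=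
  ∀ p : MvPolynomial (Fin 3 × Fin 2) ℂ, (∀ i, p ∣ form f i) → IsUnit p

/-- `ψ = (ψ 0, ψ 1, ψ 2)`, with `ψ k = (ψ k 0 : ψ k 1)`, is inverse to the map defined by `f`: both
composites are defined as rational maps and equal the identity. -/
structure IsInverse (f : Coeffs) (ψ : Fin 3 → Fin 2 → MvPolynomial (Fin 4) ℂ) : Prop where
  left_defined : ∀ k, ∃ j, aeval (form f) (ψ k j) ≠ 0
  left_eq : ∀ k, aeval (form f) (ψ k 0) * X (k, 1) = aeval (form f) (ψ k 1) * X (k, 0)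
  right_defined : ∃ i, aeval (fun v : Fin 3 × Fin 2 => ψ v.1 v.2) (form f i) ≠ 0
  right_eq : ∀ i j, aeval (fun v : Fin 3 × Fin 2 => ψ v.1 v.2) (form f i) * X j =
    aeval (fun v : Fin 3 × Fin 2 => ψ v.1 v.2) (form f j) * X i

/-- Trilinear birational maps of type `d`: the `k`-th factor of the inverse is given by two
homogeneous polynomials of degree `d k` without a common factor. -/
def IsBirationalOfType (f : Coeffs) (d : Fin 3 → ℕ) : Prop :=
  NoCommonFactor f ∧ ∃ ψ : Fin 3 → Fin 2 → MvPolynomial (Fin 4) ℂ,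
    (∀ k j, (ψ k j).IsHomogeneous (d k)) ∧ (∀ k, IsRelPrime (ψ k 0) (ψ k 1)) ∧ IsInverse f ψ

/-- The set of trilinear birational maps of type `d`, as a subset of projective space. -/
def Bir (d : Fin 3 → ℕ) : Set TrilinearSpace := {φ | IsBirationalOfType φ.rep d}

/-- The lines that are images of the `k`-th coordinate lines, where the other two factors are fixed:
`k = 0, 1, 2` gives the `s`-, `t`- and `u`-lines. Each is spanned by the images of `(1 : 0)` and
`(0 : 1)` in the `k`-th factor. -/
def parametricLines (f : Coeffs) (k : Fin 3) : Set P5 :=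
  {w | ∃ (y : Fin 3 → Fin 2 → ℂ)
      (h : plucker (evalAt f (Function.update y k ![1, 0]))
        (evalAt f (Function.update y k ![0, 1])) ≠ 0),
    w = Projectivization.mk ℂ _ h}

/-- The parametric line congruences `S`, `T`, `U` (for `k = 0, 1, 2`): the algebraic families swept
out by the parametric lines. -/
def parametricCongruence (φ : TrilinearSpace) (k : Fin 3) : Set P5 :=
  zariskiClosure (parametricLines φ.rep k)

end TrilinearCongruence

end

/-!
Let `f` be of type `(1, 1, 2)`. The linear components of its inverse give linear forms `σ₀, σ₁` and
`τ₀, τ₁` with `σⱼ(f) = sⱼ g(t, u)` and `τⱼ(f) = tⱼ h(s, u)`. If these four forms were independent,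
then `u` could be recovered from the point `f(s, t, u)` by linear forms, so the quadratic component
of the inverse would have a common factor (`IsInverse.exists_dependence`). Hence the lines `σ = 0`
and `τ = 0` meet, and in suitable coordinates `f` is
`(s₀t₀L(u) : s₁t₀L(u) : s₀t₁L(u) : F(s, t, u))` with a linear form `L` and a trilinear form `F`
(`IsReduced`, `IsBirationalOfType.exists_isReduced`). If `F` restricts at the root of `L` to a
nondegenerate bilinear form in which `s₁t₁` has a nonzero coefficient, then further coordinate
changes lead to `(s₀t₀u₀ : s₁t₀u₀ : s₀t₁u₀ : (s₀t₀ + s₁t₁)u₁)` (`IsNormalForm`,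
`IsReduced.exists_isNormalForm`), and this is birational with inverse
`((x₀ : x₁), (x₀ : x₂), (x₀² + x₁x₂ : x₀x₃))` (`IsNormalForm.isBirationalOfType`).

The open set is the locus where one of the forms `genericity ℓ u v` in the coefficients does not
vanish. They are built from covariants of `f`: the quartic `det f(·, ·, u)` in `u` is a multiple of
`L³ M`, with `M` the coefficient of `s₁t₁` in `F`; a covariant of this quartic isolates powers of
`L`, and these serve to evaluate the quadratic form `det (ℓ ∘ f(·, ·, u))` at the root of `L`. It is
dense because all but finitely many members of the pencil `F + ε (s₀t₀ + s₁t₁) K` are general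
(`Bir_subset_zariskiClosure`).

For the normal form, let `a` be the line `x₀ = x₂ = 0`, `b` the line `x₀ = x₁ = 0`, and `c` the
conic `x₃ = x₀² + x₁x₂ = 0`. The `s`-lines meet `a` and `c`, and exchanging `x₁` and `x₂`
exchanges the roles of `s` and `t`. Meeting a plane section is a closed condition on lines
(`exists_mem_linePoints_of_mem_zariskiClosure_joins`), so it extends to the closure `S`. No point
lies on all lines of `S`, so a curve that meets all of them is focal. Conversely, such a curve is
contained in the cone of lines of `S` through a general point of `a` outside the curve
(`IsCurve.subset_cone`), and two of these cones have only `a` and `c` in common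
(`focalCurves_quadratic`). The `u`-lines pass through the point `(0 : 0 : 0 : 1)`.
-/

noncomputable section

namespace TrilinearCongruence

open MvPolynomial

section

/-! ### Forms and Zariski closed sets -/

/-- `h` is the function on `ℂ^ι` defined by a homogeneous polynomial of degree `d`. -/
def IsForm {ι : Type} (d : ℕ) (h : (ι → ℂ) → ℂ) : Prop :=
  ∃ p : MvPolynomial ι ℂ, p.IsHomogeneous d ∧ ∀ x, eval x p = h x

namespace IsForm

variable {ι κ : Type} {d e : ℕ} {g h : (ι → ℂ) → ℂ}

theorem coord (i : ι) : IsForm 1 (fun x : ι → ℂ => x i) :=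
  ⟨X i, isHomogeneous_X _ _, fun x => by simp⟩

theorem zero (d : ℕ) : IsForm d (fun _ : ι → ℂ => 0) :=
  ⟨0, isHomogeneous_zero _ _ _, fun x => by simp⟩

theorem add (hg : IsForm d g) (hh : IsForm d h) : IsForm d (fun x => g x + h x) := by
  obtain ⟨p, hp, hp'⟩ := hg
  obtain ⟨q, hq, hq'⟩ := hh
  exact ⟨p + q, hp.add hq, fun x => by simp [hp', hq']⟩

theorem sub (hg : IsForm d g) (hh : IsForm d h) : IsForm d (fun x => g x - h x) := by
  obtain ⟨p, hp, hp'⟩ := hg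
  obtain ⟨q, hq, hq'⟩ := hh
  exact ⟨p - q, hp.sub hq, fun x => by simp [hp', hq']⟩

theorem mul (hg : IsForm d g) (hh : IsForm e h) : IsForm (d + e) (fun x => g x * h x) := by
  obtain ⟨p, hp, hp'⟩ := hg
  obtain ⟨q, hq, hq'⟩ := hh
  exact ⟨p * q, hp.mul hq, fun x => by simp [hp', hq']⟩

theorem const_mul (c : ℂ) (hg : IsForm d g) : IsForm d (fun x => c * g x) := by
  obtain ⟨p, hp, hp'⟩ := hg
  exact ⟨C c * p, hp.C_mul c, fun x => by simp [hp']⟩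

theorem pow (hg : IsForm d g) (n : ℕ) : IsForm (d * n) (fun x => g x ^ n) := by
  obtain ⟨p, hp, hp'⟩ := hg
  exact ⟨p ^ n, hp.pow n, fun x => by simp [hp']⟩

theorem sum {α : Type} (s : Finset α) {g : α → (ι → ℂ) → ℂ} (hg : ∀ a ∈ s, IsForm d (g a)) :
    IsForm d (fun x => ∑ a ∈ s, g a x) := by
  classical
  induction s using Finset.induction_on with
  | empty => simpa using zero d
  | insert a s ha ih =>
    simp only [Finset.sum_insert ha]
    exact (hg a (by simp)).add (ih fun b hb => hg b (by simp [hb]))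

theorem linear [Fintype ι] [DecidableEq ι] (l : (ι → ℂ) →ₗ[ℂ] ℂ) : IsForm 1 (fun x => l x) := by
  have : (fun x => l x) = fun x : ι → ℂ => ∑ i, l (Pi.single i 1) * x i := by
    funext x
    conv_lhs => rw [← LinearMap.sum_single_apply (φ := fun _ => ℂ) x, map_sum]
    refine Finset.sum_congr rfl fun i _ => ?_
    rw [mul_comm, ← smul_eq_mul, ← map_smul, ← Pi.single_smul]
    simp
  rw [this]
  exact sum _ fun i _ => (coord i).const_mul _

theorem comp {h : (κ → ℂ) → ℂ} (hh : IsForm d h) {g : κ → (ι → ℂ) → ℂ}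
    (hg : ∀ k, IsForm e (g k)) : IsForm (e * d) (fun x => h fun k => g k x) := by
  obtain ⟨p, hp, hp'⟩ := hh
  choose q hq hq' using hg
  refine ⟨aeval q p, hp.aeval q hq, fun x => ?_⟩
  have : (fun k => g k x) = fun k => eval x (q k) := funext fun k => (hq' k x).symm
  simp only [this, ← hp', ← aeval_eq_eval]
  exact comp_aeval_apply q (aeval x) p

theorem smul (hh : IsForm d h) (c : ℂ) (x : ι → ℂ) : h (c • x) = c ^ d * h x := by
  obtain ⟨p, hp, hp'⟩ := hh
  rw [← hp', ← hp', eval_eq, eval_eq, Finset.mul_sum]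
  refine Finset.sum_congr rfl fun s hs => ?_
  simp only [Pi.smul_apply, smul_eq_mul, mul_pow, Finset.prod_mul_distrib,
    Finset.prod_pow_eq_pow_sum]
  rw [← hp.degree_eq_sum_deg_support hs]
  ring

theorem eq_zero_iff_smul (hh : IsForm d h) {c : ℂ} (hc : c ≠ 0) (x : ι → ℂ) :
    h (c • x) = 0 ↔ h x = 0 := by
  rw [hh.smul]
  simp [hc]

theorem apply_zero (hh : IsForm d h) (hd : d ≠ 0) : h 0 = 0 := by
  have := hh.smul 0 0
  simpa [hd] using this

/-- The restriction of a form to an affine line is a polynomial function. -/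
theorem exists_polynomial (hh : IsForm d h) (x y : ι → ℂ) :
    ∃ P : Polynomial ℂ, ∀ t : ℂ, P.eval t = h (x + t • y) := by
  obtain ⟨p, -, hp'⟩ := hh
  refine ⟨aeval (fun i => Polynomial.C (x i) + Polynomial.X * Polynomial.C (y i)) p, fun t => ?_⟩
  rw [← hp', ← aeval_eq_eval, ← Polynomial.coe_aeval_eq_eval]
  rw [comp_aeval_apply _ (Polynomial.aeval t)]
  congr 2
  funext i
  simp only [map_add, map_mul, Polynomial.aeval_C, Polynomial.aeval_X, Pi.add_apply, Pi.smul_apply,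
    smul_eq_mul, Algebra.algebraMap_self, RingHom.id_apply]

theorem const (c : ℂ) : IsForm 0 (fun _ : ι → ℂ => c) :=
  ⟨C c, isHomogeneous_C _ _, fun x => by simp⟩

end IsForm

variable {ι : Type}

theorem exists_rep_mk {v : ι → ℂ} (hv : v ≠ 0) :
    ∃ c : ℂ, c ≠ 0 ∧ (Projectivization.mk ℂ v hv).rep = c • v := by
  obtain ⟨a, ha⟩ := Projectivization.exists_smul_eq_mk_rep ℂ v hv
  exact ⟨a, a.ne_zero, ha.symm⟩

theorem IsForm.rep_mk {d : ℕ} {h : (ι → ℂ) → ℂ} (hh : IsForm d h) {v : ι → ℂ} (hv : v ≠ 0) :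
    h (Projectivization.mk ℂ v hv).rep = 0 ↔ h v = 0 := by
  obtain ⟨c, hc, e⟩ := exists_rep_mk hv
  rw [e, hh.eq_zero_iff_smul hc]

theorem mk_eq_iff_rep {v : ι → ℂ} (hv : v ≠ 0) (x : PSpace ι) :
    x = Projectivization.mk ℂ v hv ↔ ∃ c : ℂ, x.rep = c • v := by
  conv_lhs => rw [← x.mk_rep, Projectivization.mk_eq_mk_iff']
  simp [eq_comm]

theorem isZariskiClosed_iff {Z : Set (PSpace ι)} : IsZariskiClosed Z ↔
    ∀ x ∉ Z, ∃ (d : ℕ) (h : (ι → ℂ) → ℂ), IsForm d h ∧ (∀ z ∈ Z, h z.rep = 0) ∧ h x.rep ≠ 0 := by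
  constructor
  · rintro ⟨E, hE, rfl⟩ x hx
    simp only [Set.mem_ofPred_eq, not_forall] at hx
    obtain ⟨p, hp, hpx⟩ := hx
    obtain ⟨d, hd⟩ := hE p hp
    exact ⟨d, fun x => eval x p, ⟨p, hd, fun _ => rfl⟩, fun z hz => hz p hp, hpx⟩
  · intro H
    refine ⟨{p | (∃ d, p.IsHomogeneous d) ∧ ∀ z ∈ Z, eval z.rep p = 0}, fun p hp => hp.1, ?_⟩
    ext x
    refine ⟨fun hx p hp => hp.2 x hx, fun hx => ?_⟩
    by_contra hxZ
    obtain ⟨d, h, ⟨p, hp, hp'⟩, h1, h2⟩ := H x hxZ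
    exact h2 (by rw [← hp']; exact hx p ⟨⟨d, hp⟩, fun z hz => by rw [hp', h1 z hz]⟩)

theorem IsForm.isZariskiClosed {d : ℕ} {h : (ι → ℂ) → ℂ} (hh : IsForm d h) :
    IsZariskiClosed {x : PSpace ι | h x.rep = 0} :=
  isZariskiClosed_iff.2 fun _ hx => ⟨d, h, hh, fun _ hz => hz, hx⟩

theorem isZariskiClosed_sInter {F : Set (Set (PSpace ι))} (hF : ∀ Z ∈ F, IsZariskiClosed Z) :
    IsZariskiClosed (⋂₀ F) := by
  refine isZariskiClosed_iff.2 fun x hx => ?_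
  simp only [Set.mem_sInter, not_forall] at hx
  obtain ⟨Z, hZ, hxZ⟩ := hx
  obtain ⟨d, h, h1, h2, h3⟩ := isZariskiClosed_iff.1 (hF Z hZ) x hxZ
  exact ⟨d, h, h1, fun z hz => h2 z (hz Z hZ), h3⟩

theorem IsZariskiClosed.inter {Y Z : Set (PSpace ι)} (hY : IsZariskiClosed Y)
    (hZ : IsZariskiClosed Z) : IsZariskiClosed (Y ∩ Z) := by
  rw [← Set.sInter_pair]
  exact isZariskiClosed_sInter (by rintro W (rfl | rfl) <;> assumption)

theorem IsZariskiClosed.union {Y Z : Set (PSpace ι)} (hY : IsZariskiClosed Y)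
    (hZ : IsZariskiClosed Z) : IsZariskiClosed (Y ∪ Z) := by
  refine isZariskiClosed_iff.2 fun x hx => ?_
  simp only [Set.mem_union, not_or] at hx
  obtain ⟨d, g, h1, h2, h3⟩ := isZariskiClosed_iff.1 hY x hx.1
  obtain ⟨e, h, k1, k2, k3⟩ := isZariskiClosed_iff.1 hZ x hx.2
  refine ⟨_, _, h1.mul k1, ?_, mul_ne_zero h3 k3⟩
  rintro z (hz | hz)
  · simp [h2 z hz]
  · simp [k2 z hz]

theorem isZariskiClosed_empty : IsZariskiClosed (∅ : Set (PSpace ι)) :=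
  isZariskiClosed_iff.2 fun _ _ => ⟨0, fun _ => 1, IsForm.const 1, by simp, by simp⟩

theorem isZariskiClosed_singleton (x : PSpace ι) : IsZariskiClosed {x} := by
  refine isZariskiClosed_iff.2 fun y hy => ?_
  have hx := x.rep_nonzero
  obtain ⟨i, hi⟩ : ∃ i, x.rep i ≠ 0 := by
    by_contra h
    push Not at h
    exact hx (funext h)
  by_contra H
  push Not at H
  apply hy
  have : y = Projectivization.mk ℂ x.rep x.rep_nonzero := by
    rw [mk_eq_iff_rep]
    refine ⟨y.rep i / x.rep i, funext fun j => ?_⟩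
    have := H 1 (fun v => x.rep i * v j - x.rep j * v i)
      (((IsForm.coord j).const_mul _).sub ((IsForm.coord i).const_mul _))
      (by rintro z rfl; ring)
    simp only [Pi.smul_apply, smul_eq_mul]
    field_simp
    linear_combination this
  simpa using this

theorem isZariskiClosed_of_finite {Z : Set (PSpace ι)} (hZ : Z.Finite) : IsZariskiClosed Z := by
  induction Z, hZ using Set.Finite.induction_on with
  | empty => exact isZariskiClosed_empty
  | insert _ _ ih => exact (isZariskiClosed_singleton _).union ih

theorem isZariskiClosed_zariskiClosure (A : Set (PSpace ι)) : IsZariskiClosed (zariskiClosure A) :=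
  isZariskiClosed_sInter fun _ hZ => hZ.1

theorem subset_zariskiClosure (A : Set (PSpace ι)) : A ⊆ zariskiClosure A :=
  fun _ hx _ hZ => hZ.2 hx

theorem IsForm.eq_zero_of_mem_zariskiClosure {d : ℕ} {h : (ι → ℂ) → ℂ} (hh : IsForm d h)
    {A : Set (PSpace ι)} (hA : ∀ w ∈ A, h w.rep = 0) {w : PSpace ι} (hw : w ∈ zariskiClosure A) :
    h w.rep = 0 :=
  hw {x | h x.rep = 0} ⟨hh.isZariskiClosed, hA⟩

/-! ### Irreducibility and curves -/

theorem isVariety_singleton (x : PSpace ι) : IsVariety {x} :=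
  ⟨isZariskiClosed_singleton x, Set.singleton_nonempty x, fun Z₁ Z₂ _ _ h => by
    simpa using h⟩

/-- The ideal generated by the homogeneous polynomials that vanish on `Z`. -/
def vanishingIdeal (Z : Set (PSpace ι)) : Ideal (MvPolynomial ι ℂ) :=
  Ideal.span {p | (∃ d, p.IsHomogeneous d) ∧ ∀ z ∈ Z, eval z.rep p = 0}

theorem vanishingIdeal_lt {Y Z : Set (PSpace ι)} (hY : IsZariskiClosed Y) (h : Y ⊂ Z) :
    vanishingIdeal Z < vanishingIdeal Y := by
  obtain ⟨hYZ, x, hxZ, hxY⟩ := Set.ssubset_iff_exists.1 h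
  refine lt_of_le_of_ne (Ideal.span_mono fun p hp => ⟨hp.1, fun z hz => hp.2 z (hYZ hz)⟩) ?_
  intro e
  obtain ⟨d, g, ⟨p, hp, hp'⟩, h2, h3⟩ := isZariskiClosed_iff.1 hY x hxY
  have hmem : p ∈ vanishingIdeal Z := by
    rw [e]
    exact Ideal.subset_span ⟨⟨d, hp⟩, fun z hz => by rw [hp', h2 z hz]⟩
  have hle : vanishingIdeal Z ≤ RingHom.ker (eval x.rep) :=
    Ideal.span_le.2 fun q hq => hq.2 x hxZ
  exact h3 (by rw [← hp']; exact hle hmem)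

/-- Zariski closed sets satisfy the descending chain condition, so properties of them may be
proved by Noetherian induction. -/
theorem zariskiClosed_induction [Finite ι] {P : Set (PSpace ι) → Prop}
    (H : ∀ Z, IsZariskiClosed Z → (∀ Y, IsZariskiClosed Y → Y ⊂ Z → P Y) → P Z)
    (Z : Set (PSpace ι)) (hZ : IsZariskiClosed Z) : P Z := by
  have wf : WellFounded fun I J : Ideal (MvPolynomial ι ℂ) => I > J := wellFounded_gt
  obtain ⟨I, hI⟩ : ∃ I, I = vanishingIdeal Z := ⟨_, rfl⟩
  induction I using wf.induction generalizing Z with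
  | _ I ih =>
    subst hI
    exact H Z hZ fun Y hY hYZ => ih _ (vanishingIdeal_lt hY hYZ) Y hY rfl

theorem IsCurve.finite_of_ssubset [Finite ι] {V : Set (PSpace ι)} (hV : IsCurve V)
    {Z : Set (PSpace ι)} (hZ : IsZariskiClosed Z) (hZV : Z ⊂ V) : Z.Finite := by
  revert hZV
  refine zariskiClosed_induction (P := fun Z => Z ⊂ V → Z.Finite) (fun Z hZ ih hZV => ?_) Z hZ
  by_cases hirr : IsVariety Z
  · exact (hV.2.2 Z hirr hZV).finite
  rcases Z.eq_empty_or_nonempty with rfl | hne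
  · exact Set.finite_empty
  simp only [IsVariety, hZ, hne, true_and, not_forall, not_or] at hirr
  obtain ⟨Z₁, Z₂, h₁, h₂, hsub, hn₁, hn₂⟩ := hirr
  have key : ∀ W, IsZariskiClosed W → ¬ Z ⊆ W → (Z ∩ W).Finite := fun W hW hn =>
    have hlt : Z ∩ W ⊂ Z := ⟨Set.inter_subset_left, fun h => hn fun x hx => (h hx).2⟩
    ih _ (hZ.inter hW) hlt (hlt.trans hZV)
  refine ((key Z₁ h₁ hn₁).union (key Z₂ h₂ hn₂)).subset fun x hx => ?_
  rcases hsub hx with h | h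
  · exact Or.inl ⟨hx, h⟩
  · exact Or.inr ⟨hx, h⟩

theorem IsCurve.subset_of_infinite [Finite ι] {V Z : Set (PSpace ι)} (hV : IsCurve V)
    (hZ : IsZariskiClosed Z) (h : (V ∩ Z).Infinite) : V ⊆ Z := by
  by_contra hn
  exact h (hV.finite_of_ssubset (hV.1.1.inter hZ)
    ⟨Set.inter_subset_left, fun h' => hn fun x hx => (h' hx).2⟩)

theorem IsCurve.eq_of_subset {V W : Set (PSpace ι)} (hV : IsCurve V) (hW : IsCurve W)
    (h : V ⊆ W) : V = W := by
  by_contra hne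
  exact (Set.not_subsingleton_iff.2 hV.2.1) (hW.2.2 V hV.1 (h.ssubset_of_ne hne))

theorem IsVariety.subsingleton_of_finite {V : Set (PSpace ι)} (hV : IsVariety V)
    (hf : V.Finite) : V.Subsingleton := by
  intro x hx y hy
  by_contra hne
  rcases hV.2.2 {x} (V \ {x}) (isZariskiClosed_singleton x)
    (isZariskiClosed_of_finite (hf.subset Set.sdiff_subset))
    (fun z hz => by by_cases h : z = x <;> simp [h, hz]) with h | h
  · exact hne (h hy).symm
  · exact (h hx).2 rfl

/-- A binary form that is not identically zero has finitely many zeros on the projective line. -/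
theorem IsForm.finite_zeros {d : ℕ} {h : (Fin 2 → ℂ) → ℂ} (hh : IsForm d h)
    (hne : ∃ v, h v ≠ 0) : {x : PSpace (Fin 2) | h x.rep = 0}.Finite := by
  obtain ⟨P, hP⟩ := hh.exists_polynomial ![1, 0] ![0, 1]
  have hP' : ∀ t, P.eval t = h ![1, t] := fun t => by rw [hP]; congr 1; ext i; fin_cases i <;> simp
  have hscale : ∀ v : Fin 2 → ℂ, v 0 ≠ 0 → v = v 0 • ![1, v 1 / v 0] := fun v hv => by
    ext i; fin_cases i
    · simp
    · simp; field_simp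
  have hP0 : P ≠ 0 := by
    rintro rfl
    obtain ⟨v, hv⟩ := hne
    have hz : ∀ v : Fin 2 → ℂ, v 0 ≠ 0 → h v = 0 := fun v hv => by
      rw [hscale v hv, hh.smul, ← hP']; simp
    obtain ⟨R, hR⟩ := hh.exists_polynomial v ![1, 0]
    have : R = 0 := by
      refine Polynomial.eq_zero_of_infinite_isRoot R (Set.Infinite.mono ?_
        (Set.finite_singleton (-v 0)).infinite_compl)
      intro t ht
      simp only [Polynomial.IsRoot, Set.mem_ofPred_eq, hR]
      exact hz _ (by
        simp only [Pi.add_apply, Pi.smul_apply, smul_eq_mul, Matrix.cons_val_zero, mul_one]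
        exact fun e => ht (by rw [Set.mem_singleton_iff]; linear_combination e))
    have h0 := hR 0
    rw [this, zero_smul, add_zero, Polynomial.eval_zero] at h0
    exact hv h0.symm
  have h01 : (![0, 1] : Fin 2 → ℂ) ≠ 0 := fun e => by simpa using congrFun e 1
  have h1 : ∀ t : ℂ, (![1, t] : Fin 2 → ℂ) ≠ 0 := fun t e => by simpa using congrFun e 0
  refine ((Set.finite_singleton (Projectivization.mk ℂ _ h01)).union
    ((Polynomial.finite_setOfPred_isRoot hP0).image
      fun t => Projectivization.mk ℂ _ (h1 t))).subset fun x hx => ?_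
  by_cases hx0 : x.rep 0 = 0
  · left
    rw [Set.mem_singleton_iff, mk_eq_iff_rep]
    exact ⟨x.rep 1, by ext i; fin_cases i <;> simp [hx0]⟩
  · right
    refine ⟨x.rep 1 / x.rep 0, ?_, ?_⟩
    · simp only [Set.mem_ofPred_eq, Polynomial.IsRoot, hP']
      have hx' : h x.rep = 0 := hx
      rw [hscale _ hx0, hh.smul] at hx'
      simpa [hx0] using hx'
    · exact ((mk_eq_iff_rep _ _).2 ⟨_, hscale _ hx0⟩).symm

instance : Infinite (PSpace (Fin 2)) := by
  have h1 : ∀ t : ℂ, (![1, t] : Fin 2 → ℂ) ≠ 0 := fun t e => by simpa using congrFun e 0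
  refine Infinite.of_injective (fun t : ℂ => (Projectivization.mk ℂ _ (h1 t) : PSpace (Fin 2)))
    fun s t hst => ?_
  obtain ⟨a, ha⟩ := (Projectivization.mk_eq_mk_iff' ℂ _ _ _ _).1 hst
  have h0 := congrFun ha 0
  have h1 := congrFun ha 1
  simp at h0 h1
  rw [← h1, h0, one_mul]

/-- A closed set with more than one point that is parametrized by binary forms of the same degree
is a curve. -/
theorem isCurve_of_parametrization {Z : Set (PSpace ι)} (hZ : IsZariskiClosed Z)
    (hnt : Z.Nontrivial) {e : ℕ} {γ : ι → (Fin 2 → ℂ) → ℂ} (hγ : ∀ i, IsForm e (γ i))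
    (hγ0 : ∀ v, v ≠ 0 → (fun i => γ i v) ≠ 0)
    (hγZ : ∀ x, x ∈ Z ↔ ∃ v, ∃ hv : v ≠ 0, x = Projectivization.mk ℂ _ (hγ0 v hv)) :
    IsCurve Z := by
  let Γ : PSpace (Fin 2) → PSpace ι := fun y => Projectivization.mk ℂ _ (hγ0 _ y.rep_nonzero)
  have hmk : ∀ v (hv : v ≠ 0), Γ (Projectivization.mk ℂ v hv) =
      Projectivization.mk ℂ _ (hγ0 v hv) := fun v hv => by
    obtain ⟨c, hc, hcv⟩ := exists_rep_mk hv
    rw [Projectivization.mk_eq_mk_iff']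
    refine ⟨c ^ e, ?_⟩
    funext i
    simp [hcv, (hγ i).smul]
  have hrange : Z = Set.range Γ := by
    ext x
    rw [hγZ]
    constructor
    · rintro ⟨v, hv, rfl⟩
      exact ⟨_, hmk v hv⟩
    · rintro ⟨y, rfl⟩
      exact ⟨_, y.rep_nonzero, rfl⟩
  have key : ∀ W, IsZariskiClosed W → ¬ Z ⊆ W → (Γ ⁻¹' W).Finite := by
    intro W hW hn
    obtain ⟨x, hxZ, hxW⟩ := Set.not_subset.1 hn
    obtain ⟨d, h, h1, h2, h3⟩ := isZariskiClosed_iff.1 hW x hxW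
    rw [hrange] at hxZ
    obtain ⟨y, rfl⟩ := hxZ
    refine ((h1.comp hγ).finite_zeros ⟨y.rep, ?_⟩).subset fun z hz => ?_
    · exact fun h0 => h3 ((h1.rep_mk _).2 h0)
    · exact (h1.rep_mk _).1 (h2 _ hz)
  have hirr : IsVariety Z := by
    refine ⟨hZ, hnt.nonempty, fun Z₁ Z₂ h₁ h₂ hsub => ?_⟩
    by_contra hcon
    push Not at hcon
    have hfin := (key Z₁ h₁ hcon.1).union (key Z₂ h₂ hcon.2)
    refine Set.infinite_univ (hfin.subset fun y _ => hsub ?_)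
    rw [hrange]
    exact ⟨y, rfl⟩
  refine ⟨hirr, hnt, fun W hW hWZ => hW.subsingleton_of_finite ?_⟩
  have := (key W hW.1 hWZ.2).image Γ
  rwa [Set.image_preimage_eq_of_subset (hrange ▸ hWZ.1)] at this

end

/-! ### Lines in three-space and their Plücker coordinates -/

theorem plucker_combination (x y : Fin 4 → ℂ) (a b c d : ℂ) :
    plucker (a • x + b • y) (c • x + d • y) = (a * d - b * c) • plucker x y := by
  funext i
  fin_cases i <;> simp [plucker] <;> ring

theorem linearIndependent_of_plucker_ne_zero {x y : Fin 4 → ℂ} (h : plucker x y ≠ 0) {a b : ℂ}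
    (hab : a • x + b • y = 0) : a = 0 ∧ b = 0 := by
  have h1 := plucker_combination x y a b 0 1
  have h2 := plucker_combination x y 1 0 a b
  have z1 : ∀ z, plucker 0 z = 0 := fun z => by funext i; fin_cases i <;> simp [plucker]
  have z2 : ∀ z, plucker z 0 = 0 := fun z => by funext i; fin_cases i <;> simp [plucker]
  rw [hab, z1] at h1
  rw [hab, z2] at h2
  constructor
  · simpa [h] using h1.symm
  · simpa [h] using h2.symm

theorem exists_eq_plucker {w : Fin 6 → ℂ} (hw : w ≠ 0)
    (hk : w 0 * w 3 + w 1 * w 4 + w 2 * w 5 = 0) : ∃ x y, w = plucker x y := by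
  -- Two suitable rows of the skew-symmetric matrix of `w` span the line.
  have key : ∀ (x y : Fin 4 → ℂ) (c : ℂ), c ≠ 0 → plucker x y = c • w → ∃ x y, w = plucker x y := by
    intro x y c hc h
    refine ⟨c⁻¹ • x + (0 : ℂ) • y, (0 : ℂ) • x + (1 : ℂ) • y, ?_⟩
    rw [plucker_combination, h, smul_smul]
    simp [hc]
  have hi : ∃ i, w i ≠ 0 := by
    by_contra hcon
    push Not at hcon
    exact hw (funext hcon)
  obtain ⟨i, hi⟩ := hi
  let r0 : Fin 4 → ℂ := ![0, w 0, w 1, w 2]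
  let r1 : Fin 4 → ℂ := ![-w 0, 0, w 5, -w 4]
  let r2 : Fin 4 → ℂ := ![-w 1, -w 5, 0, w 3]
  let r3 : Fin 4 → ℂ := ![-w 2, w 4, -w 3, 0]
  fin_cases i
  · exact key r0 r1 _ hi (by
      funext j; fin_cases j <;> simp [plucker, r0, r1] <;>
        first | ring1 | linear_combination hk | linear_combination -hk)
  · exact key r0 r2 _ hi (by
      funext j; fin_cases j <;> simp [plucker, r0, r2] <;>
        first | ring1 | linear_combination hk | linear_combination -hk)
  · exact key r0 r3 _ hi (by
      funext j; fin_cases j <;> simp [plucker, r0, r3] <;>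
        first | ring1 | linear_combination hk | linear_combination -hk)
  · exact key r2 r3 _ hi (by
      funext j; fin_cases j <;> simp [plucker, r2, r3] <;>
        first | ring1 | linear_combination hk | linear_combination -hk)
  · exact key r3 r1 _ hi (by
      funext j; fin_cases j <;> simp [plucker, r3, r1] <;>
        first | ring1 | linear_combination hk | linear_combination -hk)
  · exact key r1 r2 _ hi (by
      funext j; fin_cases j <;> simp [plucker, r1, r2] <;>
        first | ring1 | linear_combination hk | linear_combination -hk)

theorem mem_linePoints_of_rep {w : P5} {x y : Fin 4 → ℂ} (h : w.rep = plucker x y) (p : P3) :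
    p ∈ linePoints w ↔ p.rep ∈ Submodule.span ℂ {x, y} := by
  have h0 : plucker x y ≠ 0 := h ▸ w.rep_nonzero
  rw [← wedgeVanishes_plucker_iff x y _ h0, ← h]
  rfl

theorem mem_linePoints_mk {x y : Fin 4 → ℂ} (h : plucker x y ≠ 0) (p : P3) :
    p ∈ linePoints (Projectivization.mk ℂ _ h) ↔ p.rep ∈ Submodule.span ℂ {x, y} := by
  obtain ⟨c, hc, hcw⟩ := exists_rep_mk h
  rw [mem_linePoints_of_rep (x := c • x) (y := y)]
  · rw [Submodule.mem_span_pair, Submodule.mem_span_pair]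
    constructor
    · rintro ⟨a, b, h⟩
      exact ⟨a * c, b, by rw [← h, smul_smul]⟩
    · rintro ⟨a, b, h⟩
      exact ⟨a / c, b, by rw [← h, smul_smul, div_mul_cancel₀ _ hc]⟩
  · rw [hcw]
    have := plucker_combination x y c 0 0 1
    simpa using this.symm

/-- The set of the lines joining the pairs of points in `A`; pairs of dependent vectors do not
contribute. -/
def joins (A : Set ((Fin 4 → ℂ) × (Fin 4 → ℂ))) : Set P5 :=
  {w | ∃ z ∈ A, ∃ h : plucker z.1 z.2 ≠ 0, w = Projectivization.mk ℂ _ h}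

theorem IsForm.exists_zero_on_line {d : ℕ} {Q : (Fin 4 → ℂ) → ℂ} (hQ : IsForm d Q) (hd : d ≠ 0)
    (x y : Fin 4 → ℂ) : ∃ a b : ℂ, (a ≠ 0 ∨ b ≠ 0) ∧ Q (a • x + b • y) = 0 := by
  obtain ⟨P, hP⟩ := hQ.exists_polynomial x y
  by_cases hdeg : P.degree = 0
  · -- `Q (x + t y)` does not depend on `t`, so the leading coefficient `Q y` is zero.
    obtain ⟨c, rfl⟩ : ∃ c, P = Polynomial.C c := ⟨_, Polynomial.eq_C_of_degree_eq_zero hdeg⟩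
    refine ⟨0, 1, by simp, ?_⟩
    obtain ⟨R, hR⟩ := hQ.exists_polynomial y x
    have : R = Polynomial.C c * Polynomial.X ^ d := by
      refine Polynomial.eq_of_infinite_eval_eq _ _ (Set.Infinite.mono ?_
        (Set.finite_singleton (0 : ℂ)).infinite_compl)
      intro t ht
      have ht : t ≠ 0 := ht
      have e : y + t • x = t • (x + t⁻¹ • y) := by
        rw [smul_add, smul_smul, mul_inv_cancel₀ ht, one_smul, add_comm]
      have h1 := hP t⁻¹
      simp only [Polynomial.eval_C] at h1
      simp only [Set.mem_ofPred_eq, hR, e, hQ.smul, ← h1, Polynomial.eval_mul, Polynomial.eval_C,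
        Polynomial.eval_pow, Polynomial.eval_X]
      ring
    have h0 := hR 0
    rw [this] at h0
    simpa [hd] using h0.symm
  · obtain ⟨t, ht⟩ := IsAlgClosed.exists_root P hdeg
    exact ⟨1, t, by simp, by rw [one_smul, ← hP]; exact ht⟩

theorem klein_of_mem_zariskiClosure_joins {A : Set ((Fin 4 → ℂ) × (Fin 4 → ℂ))} {w : P5}
    (hw : w ∈ zariskiClosure (joins A)) :
    w.rep 0 * w.rep 3 + w.rep 1 * w.rep 4 + w.rep 2 * w.rep 5 = 0 := by
  have hF : IsForm 2 (fun w : Fin 6 → ℂ => w 0 * w 3 + w 1 * w 4 + w 2 * w 5) :=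
    (((IsForm.coord 0).mul (.coord 3)).add ((IsForm.coord 1).mul (.coord 4))).add
      ((IsForm.coord 2).mul (.coord 5))
  refine hF.eq_zero_of_mem_zariskiClosure ?_ hw
  rintro _ ⟨z, -, h, rfl⟩
  rw [hF.rep_mk]
  simp only [plucker, Matrix.cons_val]
  ring

theorem exists_rep_eq_plucker_of_mem_zariskiClosure_joins {A : Set ((Fin 4 → ℂ) × (Fin 4 → ℂ))}
    {w : P5} (hw : w ∈ zariskiClosure (joins A)) : ∃ x y, w.rep = plucker x y :=
  exists_eq_plucker w.rep_nonzero (klein_of_mem_zariskiClosure_joins hw)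

/-- The contraction of a bivector with a linear form. If `w` represents a line, then this is the
point in which the line meets the plane `ℓ = 0`, or zero if it lies in that plane. -/
def contraction (ℓ : (Fin 4 → ℂ) →ₗ[ℂ] ℂ) (w : Fin 6 → ℂ) : Fin 4 → ℂ :=
  ![-(ℓ (Pi.single 1 1) * w 0 + ℓ (Pi.single 2 1) * w 1 + ℓ (Pi.single 3 1) * w 2),
    ℓ (Pi.single 0 1) * w 0 - ℓ (Pi.single 2 1) * w 5 + ℓ (Pi.single 3 1) * w 4,
    ℓ (Pi.single 0 1) * w 1 + ℓ (Pi.single 1 1) * w 5 - ℓ (Pi.single 3 1) * w 3,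
    ℓ (Pi.single 0 1) * w 2 - ℓ (Pi.single 1 1) * w 4 + ℓ (Pi.single 2 1) * w 3]

theorem contraction_plucker (ℓ : (Fin 4 → ℂ) →ₗ[ℂ] ℂ) (x y : Fin 4 → ℂ) :
    contraction ℓ (plucker x y) = ℓ x • y - ℓ y • x := by
  have hl : ∀ x : Fin 4 → ℂ, ℓ x = x 0 * ℓ (Pi.single 0 1) + x 1 * ℓ (Pi.single 1 1) +
      x 2 * ℓ (Pi.single 2 1) + x 3 * ℓ (Pi.single 3 1) := fun x => by
    simp only [← smul_eq_mul, ← map_smul, ← map_add]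
    congr 1
    funext i
    fin_cases i <;> simp
  rw [hl x, hl y]
  funext i
  fin_cases i <;> simp [contraction, plucker] <;> ring

theorem isForm_contraction (ℓ : (Fin 4 → ℂ) →ₗ[ℂ] ℂ) (i : Fin 4) :
    IsForm 1 (fun w => contraction ℓ w i) := by
  have := fun (i j k : Fin 6) (a b c : ℂ) => (((IsForm.coord i).const_mul a).add
    ((IsForm.coord j).const_mul b)).add ((IsForm.coord k).const_mul c)
  fin_cases i
  · convert this 0 1 2 (-ℓ (Pi.single 1 1)) (-ℓ (Pi.single 2 1)) (-ℓ (Pi.single 3 1)) using 2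
    simp [contraction]; ring
  · convert this 0 5 4 (ℓ (Pi.single 0 1)) (-ℓ (Pi.single 2 1)) (ℓ (Pi.single 3 1)) using 2
    simp [contraction]; ring
  · convert this 1 5 3 (ℓ (Pi.single 0 1)) (ℓ (Pi.single 1 1)) (-ℓ (Pi.single 3 1)) using 2
    simp [contraction]; ring
  · convert this 2 4 3 (ℓ (Pi.single 0 1)) (-ℓ (Pi.single 1 1)) (ℓ (Pi.single 2 1)) using 2
    simp [contraction]; ring

/-- Meeting the plane section `ℓ = Q = 0` is a closed condition on lines, so it passes from the
lines of a family to those of its Zariski closure. -/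
theorem exists_mem_linePoints_of_mem_zariskiClosure_joins (ℓ : (Fin 4 → ℂ) →ₗ[ℂ] ℂ) {d : ℕ}
    {Q : (Fin 4 → ℂ) → ℂ} (hQ : IsForm d Q) (hd : d ≠ 0) {A : Set ((Fin 4 → ℂ) × (Fin 4 → ℂ))}
    (hA : ∀ z ∈ A, Q (ℓ z.1 • z.2 - ℓ z.2 • z.1) = 0) {w : P5}
    (hw : w ∈ zariskiClosure (joins A)) :
    ∃ p ∈ linePoints w, ℓ p.rep = 0 ∧ Q p.rep = 0 := by
  obtain ⟨x, y, hxy⟩ := exists_rep_eq_plucker_of_mem_zariskiClosure_joins hw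
  have h0 : plucker x y ≠ 0 := hxy ▸ w.rep_nonzero
  have hF := hQ.comp (isForm_contraction ℓ)
  have hQw : Q (ℓ x • y - ℓ y • x) = 0 := by
    have := hF.eq_zero_of_mem_zariskiClosure (A := joins A) (by
      rintro _ ⟨z, hz, h, rfl⟩
      rw [hF.rep_mk]
      exact (congrArg Q (contraction_plucker ℓ z.1 z.2)).trans (hA z hz)) hw
    rw [hxy] at this
    rw [← contraction_plucker]
    exact this
  have key : ∀ a b : ℂ, (a ≠ 0 ∨ b ≠ 0) → ℓ (a • x + b • y) = 0 → Q (a • x + b • y) = 0 →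
      ∃ p ∈ linePoints w, ℓ p.rep = 0 ∧ Q p.rep = 0 := by
    intro a b hab hl hq
    have hne : a • x + b • y ≠ 0 := fun h => by
      have := linearIndependent_of_plucker_ne_zero h0 h
      tauto
    obtain ⟨c, hc, hcv⟩ := exists_rep_mk hne
    refine ⟨Projectivization.mk ℂ _ hne, ?_, ?_, (hQ.rep_mk hne).2 hq⟩
    · rw [mem_linePoints_of_rep hxy, hcv]
      exact Submodule.smul_mem _ _ (Submodule.mem_span_pair.2 ⟨a, b, rfl⟩)
    · rw [hcv, map_smul, hl, smul_zero]
  by_cases hl : ℓ x = 0 ∧ ℓ y = 0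
  · obtain ⟨a, b, hab, hq⟩ := hQ.exists_zero_on_line hd x y
    exact key a b hab (by simp [hl.1, hl.2]) hq
  · refine key (-ℓ y) (ℓ x) ?_ ?_ ?_
    · rw [neg_ne_zero]
      tauto
    · simp only [map_add, map_smul, smul_eq_mul]
      ring
    · rw [← hQw]
      congr 1
      module

section

/-! ### The quadratic congruence in coordinates -/

theorem plucker_ne_zero {x y : Fin 4 → ℂ} (h : ∀ a b : ℂ, a • x + b • y = 0 → a = 0 ∧ b = 0) :
    plucker x y ≠ 0 := by
  intro h0
  have hij : ∀ i j, x i * y j = x j * y i := by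
    have e := fun i => congrFun h0 i
    have e0 := e 0
    have e1 := e 1
    have e2 := e 2
    have e3 := e 3
    have e4 := e 4
    have e5 := e 5
    simp only [plucker, Matrix.cons_val, Pi.zero_apply] at e0 e1 e2 e3 e4 e5
    intro i j
    fin_cases i <;> fin_cases j <;> simp <;> grind
  by_cases hx : x = 0
  · simpa using (h 1 0 (by simp [hx])).1
  · apply hx
    funext i
    have := (h (y i) (-x i) (by
      funext j
      simp only [Pi.add_apply, Pi.smul_apply, smul_eq_mul, Pi.zero_apply]
      linear_combination -hij i j)).2
    simpa using this

variable (E : (Fin 4 → ℂ) ≃ₗ[ℂ] (Fin 4 → ℂ))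

theorem exists_apply_rep_mk {v : Fin 4 → ℂ} (hv : E.symm v ≠ 0) :
    ∃ c : ℂ, c ≠ 0 ∧ E (Projectivization.mk ℂ _ hv).rep = c • v := by
  obtain ⟨c, hc, h⟩ := exists_rep_mk hv
  exact ⟨c, hc, by rw [h, map_smul, E.apply_symm_apply]⟩

theorem eq_mk_iff_apply_rep {v : Fin 4 → ℂ} (hv : E.symm v ≠ 0) (p : P3) :
    p = Projectivization.mk ℂ _ hv ↔ ∃ c : ℂ, E p.rep = c • v := by
  rw [mk_eq_iff_rep]
  refine exists_congr fun c => ?_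
  rw [← E.injective.eq_iff, map_smul, E.apply_symm_apply]

/-- The `i`-th coordinate with respect to `E`. -/
def coordinate (i : Fin 4) : (Fin 4 → ℂ) →ₗ[ℂ] ℂ := LinearMap.proj i ∘ₗ E.toLinearMap

@[simp] theorem coordinate_apply (i : Fin 4) (x : Fin 4 → ℂ) : coordinate E i x = E x i := rfl

theorem isForm_coordinate (i : Fin 4) : IsForm 1 (fun x => E x i) :=
  IsForm.linear (coordinate E i)

/-- The coordinate line `x₀ = x₂ = 0`. -/
def focalLine : Set P3 := {p | E p.rep 0 = 0 ∧ E p.rep 2 = 0}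

/-- The plane conic `x₃ = x₀² + x₁ x₂ = 0`. -/
def focalConic : Set P3 := {p | E p.rep 3 = 0 ∧ E p.rep 0 ^ 2 + E p.rep 1 * E p.rep 2 = 0}

theorem isForm_conic : IsForm 2 (fun x => E x 0 ^ 2 + E x 1 * E x 2) :=
  ((isForm_coordinate E 0).pow 2).add ((isForm_coordinate E 1).mul (isForm_coordinate E 2))

theorem isForm_symm {ι : Type} {e : ℕ} {g : Fin 4 → (ι → ℂ) → ℂ} (hg : ∀ k, IsForm e (g k))
    (i : Fin 4) : IsForm e (fun v => E.symm (fun k => g k v) i) := by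
  have := (IsForm.linear (coordinate E.symm i)).comp hg
  rwa [mul_one] at this

theorem isCurve_focalLine : IsCurve (focalLine E) := by
  let g : Fin 4 → (Fin 2 → ℂ) → ℂ := ![fun _ => 0, fun v => v 0, fun _ => 0, fun v => v 1]
  have hg : ∀ k, IsForm 1 (g k) := by
    intro k
    fin_cases k
    exacts [IsForm.zero 1, IsForm.coord 0, IsForm.zero 1, IsForm.coord 1]
  have hgv : ∀ v, (fun k => g k v) = ![0, v 0, 0, v 1] := fun v => by
    funext k; fin_cases k <;> rfl
  have hγ0 : ∀ v, v ≠ 0 → (fun i => E.symm (fun k => g k v) i) ≠ 0 := by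
    intro v hv h
    have h' : E.symm (fun k => g k v) = 0 := h
    rw [LinearEquiv.map_eq_zero_iff, hgv] at h'
    have h1 := congrFun h' 1
    have h3 := congrFun h' 3
    exact hv (by funext i; fin_cases i <;> simpa using by assumption)
  have hmem : ∀ x, x ∈ focalLine E ↔
      ∃ v, ∃ hv : v ≠ 0, x = Projectivization.mk ℂ _ (hγ0 v hv) := by
    intro x
    constructor
    · rintro ⟨h0, h2⟩
      refine ⟨![E x.rep 1, E x.rep 3], ?_, ?_⟩
      · intro h
        have h1 := congrFun h 0
        have h3 := congrFun h 1
        apply x.rep_nonzero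
        rw [← E.map_eq_zero_iff]
        funext i; fin_cases i <;> simp_all
      · refine (eq_mk_iff_apply_rep E _ x).2 ⟨1, ?_⟩
        rw [hgv]
        funext i; fin_cases i <;> simp [h0, h2]
    · rintro ⟨v, hv, hx⟩
      obtain ⟨c, hc⟩ := (eq_mk_iff_apply_rep E _ x).1 hx
      rw [hgv] at hc
      constructor <;> rw [hc] <;> simp
  refine isCurve_of_parametrization ?_ ?_ (fun i => isForm_symm E hg i) hγ0 hmem
  · exact (isForm_coordinate E 0).isZariskiClosed.inter (isForm_coordinate E 2).isZariskiClosed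
  · have h10 : (![1, 0] : Fin 2 → ℂ) ≠ 0 := fun e => by simpa using congrFun e 0
    have h01 : (![0, 1] : Fin 2 → ℂ) ≠ 0 := fun e => by simpa using congrFun e 1
    refine ⟨_, (hmem _).2 ⟨_, h10, rfl⟩, _, (hmem _).2 ⟨_, h01, rfl⟩, fun h => ?_⟩
    obtain ⟨c, hc⟩ := (eq_mk_iff_apply_rep E _ _).1 h
    obtain ⟨b, hb, hb'⟩ := exists_apply_rep_mk E (hγ0 _ h10)
    rw [hb', hgv, hgv] at hc
    have := congrFun hc 1
    simp [hb] at this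

theorem isCurve_focalConic : IsCurve (focalConic E) := by
  let g : Fin 4 → (Fin 2 → ℂ) → ℂ :=
    ![fun v => v 0 * v 1, fun v => (-1) * v 0 ^ 2, fun v => v 1 ^ 2, fun _ => 0]
  have hg : ∀ k, IsForm 2 (g k) := by
    intro k
    fin_cases k
    exacts [(IsForm.coord 0).mul (.coord 1), ((IsForm.coord 0).pow 2).const_mul _,
      (IsForm.coord 1).pow 2, IsForm.zero 2]
  have hgv : ∀ v, (fun k => g k v) = ![v 0 * v 1, -v 0 ^ 2, v 1 ^ 2, 0] := fun v => by
    funext k; fin_cases k <;> simp [g]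
  have hγ0 : ∀ v, v ≠ 0 → (fun i => E.symm (fun k => g k v) i) ≠ 0 := by
    intro v hv h
    have h' : E.symm (fun k => g k v) = 0 := h
    rw [LinearEquiv.map_eq_zero_iff, hgv] at h'
    have h1 := congrFun h' 1
    have h3 := congrFun h' 2
    simp at h1 h3
    exact hv (by funext i; fin_cases i <;> simpa using by assumption)
  have hmem : ∀ x, x ∈ focalConic E ↔
      ∃ v, ∃ hv : v ≠ 0, x = Projectivization.mk ℂ _ (hγ0 v hv) := by
    intro x
    constructor
    · rintro ⟨h3, hq⟩
      -- The parameters are `(x₀ : x₂)`, or `(1 : 0)` at the point where both vanish.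
      by_cases h2 : E x.rep 2 = 0
      · have h0 : E x.rep 0 = 0 := by simpa [h2] using hq
        refine ⟨![1, 0], fun e => by simpa using congrFun e 0, ?_⟩
        refine (eq_mk_iff_apply_rep E _ x).2 ⟨-E x.rep 1, ?_⟩
        rw [hgv]
        funext i; fin_cases i <;> simp [h0, h2, h3]
      · refine ⟨![E x.rep 0, E x.rep 2], fun e => h2 (by simpa using congrFun e 1), ?_⟩
        refine (eq_mk_iff_apply_rep E _ x).2 ⟨(E x.rep 2)⁻¹, ?_⟩
        rw [hgv]
        funext i; fin_cases i
        · simp; field_simp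
        · simp; field_simp; linear_combination hq
        · simp; field_simp
        · simp [h3]
    · rintro ⟨v, hv, hx⟩
      obtain ⟨c, hc⟩ := (eq_mk_iff_apply_rep E _ x).1 hx
      rw [hgv] at hc
      constructor
      · rw [hc]; simp
      · rw [hc]; simp; ring
  refine isCurve_of_parametrization ?_ ?_ (fun i => isForm_symm E hg i) hγ0 hmem
  · exact (isForm_coordinate E 3).isZariskiClosed.inter (isForm_conic E).isZariskiClosed
  · have h10 : (![1, 0] : Fin 2 → ℂ) ≠ 0 := fun e => by simpa using congrFun e 0
    have h01 : (![0, 1] : Fin 2 → ℂ) ≠ 0 := fun e => by simpa using congrFun e 1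
    refine ⟨_, (hmem _).2 ⟨_, h10, rfl⟩, _, (hmem _).2 ⟨_, h01, rfl⟩, fun h => ?_⟩
    obtain ⟨c, hc⟩ := (eq_mk_iff_apply_rep E _ _).1 h
    obtain ⟨b, hb, hb'⟩ := exists_apply_rep_mk E (hγ0 _ h10)
    rw [hb', hgv, hgv] at hc
    have := congrFun hc 1
    simp [hb] at this

/-- The pairs of points that span the parametric lines, in coordinates in which the trilinear map
is `(s₀t₀u₀ : s₁t₀u₀ : s₀t₁u₀ : (s₀t₀ + s₁t₁)u₁)` and `t`, `u` are fixed. -/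
def quadraticPairs : Set ((Fin 4 → ℂ) × (Fin 4 → ℂ)) :=
  Set.range fun z : (Fin 2 → ℂ) × (Fin 2 → ℂ) =>
    (E.symm ![z.1 0 * z.2 0, 0, z.1 1 * z.2 0, z.1 0 * z.2 1],
      E.symm ![0, z.1 0 * z.2 0, 0, z.1 1 * z.2 1])

theorem exists_line_mem_joins_quadraticPairs (r v : ℂ) :
    ∃ w ∈ joins (quadraticPairs E), ∀ p : P3, p ∈ linePoints w ↔
      E p.rep 2 = r * E p.rep 0 ∧ E p.rep 3 = v * E p.rep 0 + r * v * E p.rep 1 := by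
  let x : Fin 4 → ℂ := ![1, 0, r, v]
  let y : Fin 4 → ℂ := ![0, 1, 0, r * v]
  have h : plucker (E.symm x) (E.symm y) ≠ 0 := by
    refine plucker_ne_zero fun a b hab => ?_
    rw [← map_smul, ← map_smul, ← map_add, LinearEquiv.map_eq_zero_iff] at hab
    have h0 := congrFun hab 0
    have h1 := congrFun hab 1
    simp [x, y] at h0 h1
    exact ⟨h0, h1⟩
  refine ⟨_, ⟨(E.symm x, E.symm y), ⟨(![1, r], ![1, v]), by simp [x, y]⟩, h, rfl⟩, fun p => ?_⟩
  rw [mem_linePoints_mk, Submodule.mem_span_pair]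
  constructor
  · rintro ⟨a, b, hab⟩
    rw [← hab]
    simp only [map_add, map_smul, LinearEquiv.apply_symm_apply]
    simp [x, y]
    constructor <;> ring
  · rintro ⟨h2, h3⟩
    refine ⟨E p.rep 0, E p.rep 1, ?_⟩
    rw [← E.injective.eq_iff]
    simp only [map_add, map_smul, LinearEquiv.apply_symm_apply]
    funext i; fin_cases i <;> simp [x, y, h2, h3] <;> ring

theorem meetsAll_focalLine :
    MeetsAll (focalLine E) (zariskiClosure (joins (quadraticPairs E))) := by
  intro w hw
  obtain ⟨p, hp, h0, h2⟩ := exists_mem_linePoints_of_mem_zariskiClosure_joins (coordinate E 0)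
    (isForm_coordinate E 2) one_ne_zero (by
      rintro _ ⟨⟨t, u⟩, rfl⟩
      simp) hw
  exact ⟨p, ⟨h0, h2⟩, hp⟩

theorem meetsAll_focalConic :
    MeetsAll (focalConic E) (zariskiClosure (joins (quadraticPairs E))) := by
  intro w hw
  obtain ⟨p, hp, h0, h2⟩ := exists_mem_linePoints_of_mem_zariskiClosure_joins (coordinate E 3)
    (isForm_conic E) two_ne_zero (by
      rintro _ ⟨⟨t, u⟩, rfl⟩
      simp
      ring) hw
  exact ⟨p, ⟨h0, h2⟩, hp⟩

theorem not_meetsAll_of_subsingleton {W : Set P3} (hW : W.Subsingleton) :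
    ¬ MeetsAll W (zariskiClosure (joins (quadraticPairs E))) := by
  intro h
  have key : ∀ r v : ℂ, ∃ p ∈ W,
      E p.rep 2 = r * E p.rep 0 ∧ E p.rep 3 = v * E p.rep 0 + r * v * E p.rep 1 := fun r v => by
    obtain ⟨w, hw, hw'⟩ := exists_line_mem_joins_quadraticPairs E r v
    obtain ⟨p, hp, hpw⟩ := h w (subset_zariskiClosure _ hw)
    exact ⟨p, hp, (hw' p).1 hpw⟩
  obtain ⟨p, hp, h1, h2⟩ := key 1 0
  obtain ⟨q, hq, h3, h4⟩ := key 1 1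
  obtain ⟨q', hq', h5, h6⟩ := key 2 0
  obtain rfl := hW hp hq
  obtain rfl := hW hp hq'
  apply p.rep_nonzero
  rw [← E.map_eq_zero_iff]
  have e0 : E p.rep 0 = 0 := by linear_combination h1 - h5
  have e2 : E p.rep 2 = 0 := by linear_combination h1 + e0
  have e3 : E p.rep 3 = 0 := by linear_combination h2
  have e1 : E p.rep 1 = 0 := by linear_combination e3 - h4 - e0
  funext i; fin_cases i <;> assumption

theorem IsCurve.isFocal {V : Set P3} (hV : IsCurve V)
    (h : MeetsAll V (zariskiClosure (joins (quadraticPairs E)))) :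
    IsFocal V (zariskiClosure (joins (quadraticPairs E))) := by
  refine ⟨hV.1, h, fun W hW hWV hm => ?_⟩
  by_contra hne
  exact not_meetsAll_of_subsingleton E (hV.2.2 W hW (hWV.ssubset_of_ne hne)) hm

/-- The point `(0 : 1 : 0 : q)` of the focal line. -/
def focalLinePoint (q : ℂ) : P3 :=
  Projectivization.mk ℂ (E.symm ![0, 1, 0, q]) (by
    rw [ne_eq, LinearEquiv.map_eq_zero_iff]
    exact fun e => by simpa using congrFun e 1)

theorem focalLinePoint_injective : Function.Injective (focalLinePoint E) := by
  intro q r h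
  obtain ⟨c, hc⟩ := (eq_mk_iff_apply_rep E _ _).1 h
  obtain ⟨b, hb, hb'⟩ := exists_apply_rep_mk E (v := ![0, 1, 0, q]) (by
    rw [ne_eq, LinearEquiv.map_eq_zero_iff]
    exact fun e => by simpa using congrFun e 1)
  have hc' : b • ![0, 1, 0, q] = c • ![0, 1, 0, r] := hb'.symm.trans hc
  have h1 := congrFun hc' 1
  have h3 := congrFun hc' 3
  simp at h1 h3
  subst h1
  exact mul_left_cancel₀ hb h3

theorem focalLinePoint_mem (q : ℂ) : focalLinePoint E q ∈ focalLine E := by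
  obtain ⟨c, hc⟩ := (eq_mk_iff_apply_rep E _ (focalLinePoint E q)).1 rfl
  constructor <;> rw [hc] <;> simp

/-- Let `V` be a curve that meets all lines of the congruence. For a point `(0 : 1 : 0 : q)`
outside `V`, infinitely many lines of the congruence join this point to the focal conic. They have
no other point in common, so `V` meets them in infinitely many points of a quadric that contains
all of them, and therefore lies on this quadric. -/
theorem IsCurve.subset_cone {V : Set P3} (hV : IsCurve V)
    (hm : MeetsAll V (zariskiClosure (joins (quadraticPairs E)))) {q : ℂ}
    (hqV : focalLinePoint E q ∉ V) :
    V ⊆ {p | q * (E p.rep 0 ^ 2 + E p.rep 1 * E p.rep 2) - E p.rep 2 * E p.rep 3 = 0} := by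
  have hF : IsForm 2 (fun x => q * (E x 0 ^ 2 + E x 1 * E x 2) - E x 2 * E x 3) :=
    ((isForm_conic E).const_mul q).sub ((isForm_coordinate E 2).mul (isForm_coordinate E 3))
  refine hV.subset_of_infinite hF.isZariskiClosed ?_
  have key : ∀ r : ℂ, ∃ p ∈ V,
      E p.rep 2 = r * E p.rep 0 ∧
        E p.rep 3 = (q / r) * E p.rep 0 + r * (q / r) * E p.rep 1 := fun r => by
    obtain ⟨w, hw, hw'⟩ := exists_line_mem_joins_quadraticPairs E r (q / r)
    obtain ⟨p, hp, hpw⟩ := hm w (subset_zariskiClosure _ hw)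
    exact ⟨p, hp, (hw' p).1 hpw⟩
  choose f hfV hf2 hf3 using key
  refine Set.infinite_of_injOn_mapsTo (s := {0}ᶜ) (f := f) ?_ ?_
    (Set.finite_singleton (0 : ℂ)).infinite_compl
  · intro r hr r' hr' h
    have hr : r ≠ 0 := hr
    by_contra hne
    have e2 := hf2 r
    have e2' := hf2 r'
    have e3 := hf3 r
    rw [← h] at e2'
    have e0 : E (f r).rep 0 = 0 := by
      have : (r - r') * E (f r).rep 0 = 0 := by linear_combination e2' - e2
      simpa [sub_eq_zero, hne] using this
    apply hqV
    convert hfV r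
    refine ((eq_mk_iff_apply_rep E _ (f r)).2 ⟨E (f r).rep 1, ?_⟩).symm
    rw [e0] at e2 e3
    rw [mul_div_cancel₀ _ hr] at e3
    funext i; fin_cases i <;> simp [e0, e2, e3]
    ring
  · intro r hr
    have hr : r ≠ 0 := hr
    refine ⟨hfV r, ?_⟩
    simp only [Set.mem_ofPred_eq]
    rw [hf3, hf2]
    field_simp
    ring

theorem focalCurves_quadratic :
    focalCurves (zariskiClosure (joins (quadraticPairs E))) = {focalLine E, focalConic E} := by
  apply Set.Subset.antisymm
  · rintro V ⟨hV, hVf⟩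
    rw [Set.mem_insert_iff, Set.mem_singleton_iff]
    by_cases hVa : V ⊆ focalLine E
    · exact Or.inl (hV.eq_of_subset (isCurve_focalLine E) hVa)
    have hfin : (V ∩ focalLine E).Finite := by
      by_contra hinf
      exact hVa (hV.subset_of_infinite (isCurve_focalLine E).1.1 hinf)
    have hbad : (focalLinePoint E ⁻¹' (V ∩ focalLine E)).Finite :=
      hfin.preimage (focalLinePoint_injective E).injOn
    obtain ⟨q, hq, r, hr, hqr⟩ := hbad.infinite_compl.nontrivial
    have h1 := hV.subset_cone E hVf.2.1 fun h => hq ⟨h, focalLinePoint_mem E q⟩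
    have h2 := hV.subset_cone E hVf.2.1 fun h => hr ⟨h, focalLinePoint_mem E r⟩
    rcases hV.1.2.2 _ _ (isCurve_focalLine E).1.1 (isCurve_focalConic E).1.1 (by
      intro p hp
      have k1 : _ = _ := h1 hp
      have k2 : _ = _ := h2 hp
      have hc : E p.rep 0 ^ 2 + E p.rep 1 * E p.rep 2 = 0 := by
        have : (q - r) * (E p.rep 0 ^ 2 + E p.rep 1 * E p.rep 2) = 0 := by
          linear_combination k1 - k2
        simpa [sub_eq_zero, hqr] using this
      have h23 : E p.rep 2 * E p.rep 3 = 0 := by linear_combination q * hc - k1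
      rcases mul_eq_zero.1 h23 with h | h
      · exact Or.inl ⟨by simpa [h] using hc, h⟩
      · exact Or.inr ⟨h, hc⟩) with h | h
    · exact Or.inl (hV.eq_of_subset (isCurve_focalLine E) h)
    · exact Or.inr (hV.eq_of_subset (isCurve_focalConic E) h)
  · rintro V (rfl | rfl)
    · exact ⟨isCurve_focalLine E, (isCurve_focalLine E).isFocal E (meetsAll_focalLine E)⟩
    · exact ⟨isCurve_focalConic E, (isCurve_focalConic E).isFocal E (meetsAll_focalConic E)⟩

end

section

/-! ### The congruences of the normal form -/

/-- The trilinear map `(s₀t₀u₀ : s₁t₀u₀ : s₀t₁u₀ : (s₀t₀ + s₁t₁)u₁)`. -/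
def normalMap (z : Fin 3 → Fin 2 → ℂ) : Fin 4 → ℂ :=
  ![z 0 0 * z 1 0 * z 2 0, z 0 1 * z 1 0 * z 2 0, z 0 0 * z 1 1 * z 2 0,
    (z 0 0 * z 1 0 + z 0 1 * z 1 1) * z 2 1]

/-- The coordinate changes `E` in the target and `R k` in the factors bring `f` into the form
`normalMap`. -/
def IsNormalForm (f : Coeffs) (E : (Fin 4 → ℂ) ≃ₗ[ℂ] (Fin 4 → ℂ))
    (R : Fin 3 → (Fin 2 → ℂ) ≃ₗ[ℂ] (Fin 2 → ℂ)) : Prop :=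
  ∀ y, E (evalAt f y) = normalMap fun k => R k (y k)

theorem det_ne_zero_of_equiv (R : (Fin 2 → ℂ) ≃ₗ[ℂ] (Fin 2 → ℂ)) :
    R ![1, 0] 0 * R ![0, 1] 1 - R ![1, 0] 1 * R ![0, 1] 0 ≠ 0 := by
  intro h
  have hR : ∀ v, R v = v 0 • R ![1, 0] + v 1 • R ![0, 1] := fun v => by
    rw [← map_smul, ← map_smul, ← map_add]
    congr 1
    funext i; fin_cases i <;> simp
  have h1 : R ![R ![0, 1] 1, -R ![1, 0] 1] = 0 := by
    rw [hR]
    funext i; fin_cases i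
    · simp; linear_combination h
    · simp; ring
  have h2 : R ![R ![0, 1] 0, -R ![1, 0] 0] = 0 := by
    rw [hR]
    funext i; fin_cases i
    · simp; ring
    · simp; linear_combination -h
  rw [R.map_eq_zero_iff] at h1 h2
  have e1 : R ![1, 0] 1 = 0 := by simpa using congrFun h1 1
  have e0 : R ![1, 0] 0 = 0 := by simpa using congrFun h2 1
  have : (![1, 0] : Fin 2 → ℂ) = 0 := by
    rw [← R.map_eq_zero_iff]
    funext i; fin_cases i <;> assumption
  simpa using congrFun this 0

theorem normalMap_update (z : Fin 3 → Fin 2 → ℂ) (k : Fin 3) (v : Fin 2 → ℂ) :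
    normalMap (Function.update z k v) = v 0 • normalMap (Function.update z k ![1, 0]) +
      v 1 • normalMap (Function.update z k ![0, 1]) := by
  funext i
  fin_cases k <;> fin_cases i <;> simp [normalMap, Function.update] <;> ring

variable {f : Coeffs} {E : (Fin 4 → ℂ) ≃ₗ[ℂ] (Fin 4 → ℂ)}
  {R : Fin 3 → (Fin 2 → ℂ) ≃ₗ[ℂ] (Fin 2 → ℂ)}

theorem joins_range_congr {α β : Type*} {F : α → (Fin 4 → ℂ) × (Fin 4 → ℂ)}
    {G : β → (Fin 4 → ℂ) × (Fin 4 → ℂ)} (r : α → β) (hr : Function.Surjective r)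
    (h : ∀ a, ∃ c : ℂ, c ≠ 0 ∧ plucker (F a).1 (F a).2 = c • plucker (G (r a)).1 (G (r a)).2) :
    joins (Set.range F) = joins (Set.range G) := by
  ext w
  constructor
  · rintro ⟨_, ⟨a, rfl⟩, h0, rfl⟩
    obtain ⟨c, hc, e⟩ := h a
    have h0' : plucker (G (r a)).1 (G (r a)).2 ≠ 0 := fun hz => h0 (by rw [e, hz, smul_zero])
    exact ⟨_, ⟨r a, rfl⟩, h0', (Projectivization.mk_eq_mk_iff' ℂ _ _ _ _).2 ⟨c, e.symm⟩⟩
  · rintro ⟨_, ⟨b, rfl⟩, h0, rfl⟩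
    obtain ⟨a, rfl⟩ := hr b
    obtain ⟨c, hc, e⟩ := h a
    refine ⟨_, ⟨a, rfl⟩, by rw [e]; exact smul_ne_zero hc h0,
      (Projectivization.mk_eq_mk_iff' ℂ _ _ _ _).2 ⟨c⁻¹, ?_⟩⟩
    rw [e, smul_smul, inv_mul_cancel₀ hc, one_smul]

/-- The coordinate change in the `k`-th factor multiplies the Plücker coordinates of the lines by
its determinant. -/
theorem IsNormalForm.parametricLines_eq (hf : IsNormalForm f E R) (k : Fin 3) :
    parametricLines f k = joins (Set.range fun z : Fin 3 → Fin 2 → ℂ =>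
      (E.symm (normalMap (Function.update z k ![1, 0])),
        E.symm (normalMap (Function.update z k ![0, 1])))) := by
  have h0 : parametricLines f k = joins (Set.range fun y : Fin 3 → Fin 2 → ℂ =>
      (evalAt f (Function.update y k ![1, 0]), evalAt f (Function.update y k ![0, 1]))) := by
    ext w
    constructor
    · rintro ⟨y, h, rfl⟩
      exact ⟨_, ⟨y, rfl⟩, h, rfl⟩
    · rintro ⟨_, ⟨y, rfl⟩, h, rfl⟩
      exact ⟨y, h, rfl⟩
  rw [h0]
  refine joins_range_congr (fun y k => R k (y k)) (fun z => ⟨fun k => (R k).symm (z k), by simp⟩)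
    fun y => ⟨_, det_ne_zero_of_equiv (R k), ?_⟩
  have hev : ∀ v, evalAt f (Function.update y k v) =
      R k v 0 • E.symm (normalMap (Function.update (fun k => R k (y k)) k ![1, 0])) +
      R k v 1 • E.symm (normalMap (Function.update (fun k => R k (y k)) k ![0, 1])) := fun v => by
    rw [← map_smul, ← map_smul, ← map_add, ← normalMap_update, LinearEquiv.eq_symm_apply, hf]
    congr 1
    funext j
    by_cases hj : j = k
    · subst hj; simp
    · simp [hj]
  dsimp only
  rw [hev, hev, plucker_combination]

variable (E) in
/-- Coordinates with `x₁` and `x₂` exchanged. -/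
def swapCoordinates : (Fin 4 → ℂ) ≃ₗ[ℂ] (Fin 4 → ℂ) :=
  E.trans (LinearEquiv.funCongrLeft ℂ ℂ (Equiv.swap 1 2))

theorem swapCoordinates_apply (x : Fin 4 → ℂ) :
    swapCoordinates E x = ![E x 0, E x 2, E x 1, E x 3] := by
  funext i
  fin_cases i <;> rfl

theorem swapCoordinates_symm_apply (a b c d : ℂ) :
    (swapCoordinates E).symm ![a, b, c, d] = E.symm ![a, c, b, d] := by
  rw [LinearEquiv.symm_apply_eq, swapCoordinates_apply]
  simp

theorem focalConic_swapCoordinates : focalConic (swapCoordinates E) = focalConic E := by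
  ext p
  simp [focalConic, swapCoordinates_apply, mul_comm]

theorem mem_focalLine_swapCoordinates {p : P3} :
    p ∈ focalLine (swapCoordinates E) ↔ E p.rep 0 = 0 ∧ E p.rep 1 = 0 := by
  simp [focalLine, swapCoordinates_apply]

theorem IsNormalForm.parametricLines_zero (hf : IsNormalForm f E R) :
    parametricLines f 0 = joins (quadraticPairs E) := by
  rw [hf.parametricLines_eq]
  refine joins_range_congr (fun z => (z 1, z 2)) (fun tu => ⟨![0, tu.1, tu.2], rfl⟩) fun z =>
    ⟨1, one_ne_zero, ?_⟩
  simp [normalMap, Function.update]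

theorem IsNormalForm.parametricLines_one (hf : IsNormalForm f E R) :
    parametricLines f 1 = joins (quadraticPairs (swapCoordinates E)) := by
  rw [hf.parametricLines_eq]
  refine joins_range_congr (fun z => (z 0, z 2)) (fun tu => ⟨![tu.1, 0, tu.2], rfl⟩) fun z =>
    ⟨1, one_ne_zero, ?_⟩
  simp [normalMap, Function.update, swapCoordinates_symm_apply]

variable (E) in
/-- The `i`-th coordinate point with respect to `E`. -/
def coordinatePoint (i : Fin 4) : P3 :=
  Projectivization.mk ℂ (E.symm (Pi.single i 1)) (by simp)

theorem eq_coordinatePoint_iff (i : Fin 4) (p : P3) :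
    p = coordinatePoint E i ↔ ∀ j ≠ i, E p.rep j = 0 := by
  rw [coordinatePoint, eq_mk_iff_apply_rep]
  constructor
  · rintro ⟨c, hc⟩ j hj
    rw [hc]
    simp [hj]
  · intro h
    refine ⟨E p.rep i, funext fun j => ?_⟩
    by_cases hj : j = i
    · subst hj; simp
    · simp [hj, h j hj]

/-- All `u`-lines pass through the last coordinate point, and no other point lies on all of
them. -/
theorem IsNormalForm.focalPoints_two (hf : IsNormalForm f E R) :
    focalPoints (zariskiClosure (parametricLines f 2)) = {coordinatePoint E 3} := by
  have hmeets : MeetsAll {coordinatePoint E 3} (zariskiClosure (parametricLines f 2)) := by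
    intro w hw
    refine ⟨_, rfl, ?_⟩
    set x := (coordinatePoint E 3).rep with hx
    have hlin : ∀ w ∈ parametricLines f 2, WedgeVanishes w.rep x := by
      rw [hf.parametricLines_eq]
      rintro _ ⟨_, ⟨z, rfl⟩, h, rfl⟩
      refine (mem_linePoints_mk h (coordinatePoint E 3)).2 ?_
      obtain ⟨c, hc⟩ := (eq_mk_iff_apply_rep E _ (coordinatePoint E 3)).1 rfl
      rw [← LinearEquiv.eq_symm_apply] at hc
      have hy : normalMap (Function.update z 2 ![0, 1]) =
          (z 0 0 * z 1 0 + z 0 1 * z 1 1) • Pi.single 3 1 := by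
        funext i; fin_cases i <;> simp [normalMap, Function.update]
      have hne : z 0 0 * z 1 0 + z 0 1 * z 1 1 ≠ 0 := by
        intro h0
        apply h
        simp only [hy, h0, zero_smul, map_zero]
        funext i; fin_cases i <;> simp [plucker]
      rw [hc, Submodule.mem_span_pair]
      refine ⟨0, c / (z 0 0 * z 1 0 + z 0 1 * z 1 1), ?_⟩
      simp only [hy, map_smul, zero_smul, zero_add, smul_smul]
      rw [div_mul_cancel₀ _ hne]
    have hw' : ∀ (i j k : Fin 6) (a b c : ℂ),
        (∀ w ∈ parametricLines f 2, a * w.rep i + b * w.rep j + c * w.rep k = 0) →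
        a * w.rep i + b * w.rep j + c * w.rep k = 0 := fun i j k a b c h =>
      ((((IsForm.coord i).const_mul a).add ((IsForm.coord j).const_mul b)).add
        ((IsForm.coord k).const_mul c)).eq_zero_of_mem_zariskiClosure h hw
    refine ⟨?_, ?_, ?_, ?_⟩
    · linear_combination hw' 5 1 0 (x 0) (-x 1) (x 2) fun w hw => by
        linear_combination (hlin w hw).1
    · linear_combination hw' 4 2 0 (x 0) (x 1) (-x 3) fun w hw => by
        linear_combination (hlin w hw).2.1
    · linear_combination hw' 3 2 1 (x 0) (-x 2) (x 3) fun w hw => by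
        linear_combination (hlin w hw).2.2.1
    · linear_combination hw' 3 4 5 (x 1) (x 2) (x 3) fun w hw => by
        linear_combination (hlin w hw).2.2.2
  apply Set.Subset.antisymm
  · rintro p ⟨-, hm, -⟩
    have key : ∀ s : ℂ, E p.rep 1 = s * E p.rep 0 ∧ E p.rep 2 = 0 := by
      intro s
      have h : plucker (E.symm ![1, s, 0, 0]) (E.symm ![0, 0, 0, 1]) ≠ 0 := by
        refine plucker_ne_zero fun a b hab => ?_
        rw [← map_smul, ← map_smul, ← map_add, LinearEquiv.map_eq_zero_iff] at hab
        have h0 := congrFun hab 0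
        have h1 := congrFun hab 3
        simp at h0 h1
        exact ⟨h0, h1⟩
      obtain ⟨q, rfl, hq⟩ := hm (Projectivization.mk ℂ _ h) (subset_zariskiClosure _ (by
        rw [hf.parametricLines_eq]
        refine ⟨_, ⟨![![1, s], ![1, 0], 0], rfl⟩, ?_⟩
        have e1 : normalMap (Function.update ![![1, s], ![1, 0], 0] 2 ![1, 0]) =
            ![1, s, 0, 0] := by
          funext i; fin_cases i <;> simp [normalMap, Function.update]
        have e2 : normalMap (Function.update ![![1, s], ![1, 0], 0] 2 ![0, 1]) =
            ![0, 0, 0, 1] := by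
          funext i; fin_cases i <;> simp [normalMap, Function.update]
        dsimp only
        simp only [e1, e2]
        exact ⟨h, trivial⟩))
      rw [mem_linePoints_mk, Submodule.mem_span_pair] at hq
      obtain ⟨a, b, hab⟩ := hq
      rw [← hab]
      simp only [map_add, map_smul, LinearEquiv.apply_symm_apply]
      simp
      ring
    have h0 := key 0
    have h1 := key 1
    have e1 : E p.rep 1 = 0 := by linear_combination h0.1
    have e0 : E p.rep 0 = 0 := by linear_combination e1 - h1.1
    refine (eq_coordinatePoint_iff 3 p).2 fun j hj => ?_
    fin_cases j
    exacts [e0, e1, h0.2, absurd rfl hj]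
  · rintro _ rfl
    refine ⟨isVariety_singleton _, hmeets, fun W hW hsub _ => ?_⟩
    exact (Set.subset_singleton_iff_eq.1 hsub).resolve_left hW.2.1.ne_empty

/-! ### The focal line, the focal conic and their planes -/

theorem isLine_focalLine : IsLine (focalLine E) := by
  let i : (Fin 2 → ℂ) →ₗ[ℂ] (Fin 4 → ℂ) :=
    { toFun v := ![0, v 0, 0, v 1]
      map_add' _ _ := by funext j; fin_cases j <;> simp
      map_smul' _ _ := by funext j; fin_cases j <;> simp }
  have hi : Function.Injective (E.symm.toLinearMap ∘ₗ i) := by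
    refine E.symm.injective.comp fun v w h => ?_
    have h1 : v 0 = w 0 := congrFun h 1
    have h3 : v 1 = w 1 := congrFun h 3
    funext j; fin_cases j <;> assumption
  refine ⟨LinearMap.range (E.symm.toLinearMap ∘ₗ i), ?_, ?_⟩
  · rw [LinearMap.finrank_range_of_inj hi]
    simp
  · ext p
    constructor
    · rintro ⟨h0, h2⟩
      refine ⟨![E p.rep 1, E p.rep 3], ?_⟩
      change E.symm _ = _
      rw [LinearEquiv.symm_apply_eq]
      funext j; fin_cases j <;> simp [i, h0, h2]
    · rintro ⟨v, hv⟩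
      have hv : E.symm (i v) = p.rep := hv
      constructor <;> rw [← hv, E.apply_symm_apply] <;> rfl

variable (E) in
/-- The vectors whose `i`-th coordinate with respect to `E` vanishes. -/
def coordinateHyperplane (i : Fin 4) : Submodule ℂ (Fin 4 → ℂ) := LinearMap.ker (coordinate E i)

theorem mem_coordinateHyperplane {i : Fin 4} {x : Fin 4 → ℂ} :
    x ∈ coordinateHyperplane E i ↔ E x i = 0 := Iff.rfl

theorem finrank_coordinateHyperplane (i : Fin 4) :
    Module.finrank ℂ (coordinateHyperplane E i) = 3 := by
  have h := LinearMap.finrank_range_add_finrank_ker (coordinate E i)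
  have hs : LinearMap.range (coordinate E i) = ⊤ := by
    rw [LinearMap.range_eq_top]
    intro c
    exact ⟨E.symm (Pi.single i c), by simp⟩
  rw [hs, finrank_top] at h
  simp at h
  rw [coordinateHyperplane]
  omega

theorem isPlaneConic_focalConic : IsPlaneConic (focalConic E) := by
  refine ⟨coordinateHyperplane E 3,
    (QuadraticMap.linMulLin (coordinate E 0) (coordinate E 0) +
      QuadraticMap.linMulLin (coordinate E 1) (coordinate E 2)).comp
        (coordinateHyperplane E 3).subtype, finrank_coordinateHyperplane 3, ?_, ?_⟩
  · intro x hx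
    have key : ∀ i : Fin 4, i ≠ 3 →
        2 * E x 0 * (Pi.single i 1 : Fin 4 → ℂ) 0 + E x 1 * (Pi.single i 1 : Fin 4 → ℂ) 2 +
          E x 2 * (Pi.single i 1 : Fin 4 → ℂ) 1 = 0 := by
      intro i hi
      have := hx ⟨E.symm (Pi.single i 1), by
        rw [mem_coordinateHyperplane, E.apply_symm_apply]
        simp [hi.symm]⟩
      simp only [QuadraticMap.polar, QuadraticMap.comp_apply, add_apply,
        QuadraticMap.linMulLin_apply, coordinate_apply, Submodule.subtype_apply,
        map_add, E.apply_symm_apply] at this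
      linear_combination this
    have h0 := key 0 (by decide)
    have h1 := key 1 (by decide)
    have h2 := key 2 (by decide)
    simp at h0 h1 h2
    have h3 : E x 3 = 0 := x.2
    apply Subtype.ext
    rw [Submodule.coe_zero, ← E.map_eq_zero_iff]
    funext j; fin_cases j <;> assumption
  · ext p
    simp [focalConic, mem_coordinateHyperplane, sq]

theorem IsNormalForm.congruences {φ : TrilinearSpace} (hf : IsNormalForm φ.rep E R) :
    ∃ a b c : Set P3, IsLine a ∧ IsLine b ∧ a ≠ b ∧ IsPlaneConic c ∧
      (∃ H, IsPlane H ∧ a ⊆ H ∧ b ⊆ H) ∧ (∃ P, a ∩ c = {P}) ∧ (∃ Q, b ∩ c = {Q}) ∧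
      (IsQuadratic (parametricCongruence φ 0) ∧
        focalCurves (parametricCongruence φ 0) = {a, c}) ∧
      (IsQuadratic (parametricCongruence φ 1) ∧
        focalCurves (parametricCongruence φ 1) = {b, c}) ∧
      (IsDegenerate (parametricCongruence φ 2) ∧
        ∃ O, a ∩ b = {O} ∧ focalPoints (parametricCongruence φ 2) = {O}) := by
  have hcoord : ∀ i, ∀ j ≠ i, E (coordinatePoint E i).rep j = 0 := fun i =>
    (eq_coordinatePoint_iff i _).1 rfl
  have hac : ∀ E : (Fin 4 → ℂ) ≃ₗ[ℂ] (Fin 4 → ℂ),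
      focalLine E ∩ focalConic E = {coordinatePoint E 1} := by
    intro E
    ext p
    rw [Set.mem_singleton_iff, eq_coordinatePoint_iff]
    constructor
    · rintro ⟨⟨h0, h2⟩, h3, -⟩ j hj
      fin_cases j
      exacts [h0, absurd rfl hj, h2, h3]
    · intro h
      have h0 := h 0 (by decide)
      have h2 := h 2 (by decide)
      exact ⟨⟨h0, h2⟩, h 3 (by decide), by simp [h0, h2]⟩
  have hquad : ∀ E : (Fin 4 → ℂ) ≃ₗ[ℂ] (Fin 4 → ℂ),
      IsQuadratic (zariskiClosure (joins (quadraticPairs E))) := fun E =>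
    ⟨focalConic E, focalLine E, isPlaneConic_focalConic, isLine_focalLine,
      (isCurve_focalConic E).isFocal E (meetsAll_focalConic E),
      (isCurve_focalLine E).isFocal E (meetsAll_focalLine E), by rw [hac]; simp⟩
  refine ⟨focalLine E, focalLine (swapCoordinates E), focalConic E, isLine_focalLine,
    isLine_focalLine, ?_, isPlaneConic_focalConic, ?_, ⟨_, hac E⟩, ?_, ?_, ?_, ?_⟩
  · intro h
    have h1 : coordinatePoint E 1 ∈ focalLine E :=
      ⟨hcoord 1 0 (by decide), hcoord 1 2 (by decide)⟩
    rw [h, mem_focalLine_swapCoordinates] at h1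
    apply (coordinatePoint E 1).rep_nonzero
    rw [← E.map_eq_zero_iff]
    funext j
    by_cases hj : j = 1
    · subst hj; exact h1.2
    · exact hcoord 1 j hj
  · refine ⟨linearSet (coordinateHyperplane E 0), ⟨_, finrank_coordinateHyperplane 0, rfl⟩,
      fun p hp => hp.1, fun p hp => (mem_focalLine_swapCoordinates.1 hp).1⟩
  · rw [← focalConic_swapCoordinates]
    exact ⟨_, hac _⟩
  · rw [parametricCongruence, hf.parametricLines_zero]
    exact ⟨hquad E, focalCurves_quadratic E⟩
  · rw [parametricCongruence, hf.parametricLines_one]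
    exact ⟨hquad _, by rw [focalCurves_quadratic, focalConic_swapCoordinates]⟩
  · refine ⟨⟨_, hf.focalPoints_two⟩, coordinatePoint E 3, ?_, hf.focalPoints_two⟩
    ext p
    rw [Set.mem_inter_iff, mem_focalLine_swapCoordinates, Set.mem_singleton_iff,
      eq_coordinatePoint_iff]
    constructor
    · rintro ⟨⟨h0, h2⟩, -, h1⟩ j hj
      fin_cases j
      exacts [h0, h1, h2, absurd rfl hj]
    · intro h
      exact ⟨⟨h 0 (by decide), h 2 (by decide)⟩, h 0 (by decide), h 1 (by decide)⟩

end

/-! ### Maps of type `(1, 1, 2)` -/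

theorem evalAt_apply (f : Coeffs) (y : Fin 3 → Fin 2 → ℂ) (i : Fin 4) :
    evalAt f y i = ∑ j : Fin 2, ∑ k : Fin 2, ∑ l : Fin 2,
      f (i, j, k, l) * y 0 j * y 1 k * y 2 l := by
  simp [evalAt, form]

theorem eval_aeval_form (f : Coeffs) (y : Fin 3 → Fin 2 → ℂ) (p : MvPolynomial (Fin 4) ℂ) :
    eval (fun v => y v.1 v.2) (aeval (form f) p) = eval (evalAt f y) p := by
  rw [← aeval_eq_eval, ← aeval_eq_eval]
  exact comp_aeval_apply (form f) (aeval fun v => y v.1 v.2) p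

theorem eval_aeval_components (f : Coeffs) (ψ : Fin 3 → Fin 2 → MvPolynomial (Fin 4) ℂ)
    (x : Fin 4 → ℂ) (i : Fin 4) :
    eval x (aeval (fun v : Fin 3 × Fin 2 => ψ v.1 v.2) (form f i)) =
      evalAt f (fun k j => eval x (ψ k j)) i := by
  rw [← aeval_eq_eval]
  exact comp_aeval_apply _ (aeval x) (form f i)

theorem evalAt_fst (f : Coeffs) (a b : ℂ) (s s' t u : Fin 2 → ℂ) :
    evalAt f ![a • s + b • s', t, u] = a • evalAt f ![s, t, u] + b • evalAt f ![s', t, u] := by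
  funext i
  simp [evalAt_apply]
  ring

theorem evalAt_snd (f : Coeffs) (a b : ℂ) (s t t' u : Fin 2 → ℂ) :
    evalAt f ![s, a • t + b • t', u] = a • evalAt f ![s, t, u] + b • evalAt f ![s, t', u] := by
  funext i
  simp [evalAt_apply]
  ring

theorem evalAt_trd (f : Coeffs) (a b : ℂ) (s t u u' : Fin 2 → ℂ) :
    evalAt f ![s, t, a • u + b • u'] = a • evalAt f ![s, t, u] + b • evalAt f ![s, t, u'] := by
  funext i
  simp [evalAt_apply]
  ring

/-- The `u`-line of `f` for fixed `s` and `t`, as a linear map. -/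
def uLine (f : Coeffs) (s t : Fin 2 → ℂ) : (Fin 2 → ℂ) →ₗ[ℂ] (Fin 4 → ℂ) where
  toFun u := evalAt f ![s, t, u]
  map_add' u v := by funext i; simp [evalAt_apply]; ring
  map_smul' c u := by funext i; simp [evalAt_apply]; ring

theorem uLine_apply (f : Coeffs) (s t u : Fin 2 → ℂ) : uLine f s t u = evalAt f ![s, t, u] := rfl

theorem eq_combination (v : Fin 2 → ℂ) : v = v 0 • ![1, 0] + v 1 • ![0, 1] := by
  funext i; fin_cases i <;> simp

/-- If two linear forms `σ₀`, `σ₁` recover the first parameter, then `σⱼ ∘ f = sⱼ g` with `g`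
independent of `s`. -/
theorem apply_evalAt_fst {f : Coeffs} {σ : Fin 2 → (Fin 4 → ℂ) →ₗ[ℂ] ℂ}
    (h : ∀ s t u, σ 0 (evalAt f ![s, t, u]) * s 1 = σ 1 (evalAt f ![s, t, u]) * s 0)
    (j : Fin 2) (s t u : Fin 2 → ℂ) :
    σ j (evalAt f ![s, t, u]) = s j * σ 0 (evalAt f ![![1, 0], t, u]) := by
  have h10 := h ![1, 0] t u
  have h01 := h ![0, 1] t u
  have h11 := h ((1 : ℂ) • ![1, 0] + (1 : ℂ) • ![0, 1]) t u
  have hs := evalAt_fst f (s 0) (s 1) ![1, 0] ![0, 1] t u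
  rw [← eq_combination] at hs
  rw [evalAt_fst] at h11
  have e10 : σ 1 (evalAt f ![![1, 0], t, u]) = 0 := by simpa using h10.symm
  have e01 : σ 0 (evalAt f ![![0, 1], t, u]) = 0 := by simpa using h01
  have e11 : σ 0 (evalAt f ![![1, 0], t, u]) = σ 1 (evalAt f ![![0, 1], t, u]) := by
    simpa [e10, e01] using h11
  rw [hs]
  fin_cases j
  · simp [e01]
  · simp [e10, e11]

theorem apply_evalAt_snd {f : Coeffs} {σ : Fin 2 → (Fin 4 → ℂ) →ₗ[ℂ] ℂ}
    (h : ∀ s t u, σ 0 (evalAt f ![s, t, u]) * t 1 = σ 1 (evalAt f ![s, t, u]) * t 0)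
    (j : Fin 2) (s t u : Fin 2 → ℂ) :
    σ j (evalAt f ![s, t, u]) = t j * σ 0 (evalAt f ![s, ![1, 0], u]) := by
  have h10 := h s ![1, 0] u
  have h01 := h s ![0, 1] u
  have h11 := h s ((1 : ℂ) • ![1, 0] + (1 : ℂ) • ![0, 1]) u
  have hs := evalAt_snd f (t 0) (t 1) s ![1, 0] ![0, 1] u
  rw [← eq_combination] at hs
  rw [evalAt_snd] at h11
  have e10 : σ 1 (evalAt f ![s, ![1, 0], u]) = 0 := by simpa using h10.symm
  have e01 : σ 0 (evalAt f ![s, ![0, 1], u]) = 0 := by simpa using h01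
  have e11 : σ 0 (evalAt f ![s, ![1, 0], u]) = σ 1 (evalAt f ![s, ![0, 1], u]) := by
    simpa [e10, e01] using h11
  rw [hs]
  fin_cases j
  · simp [e01]
  · simp [e10, e11]

theorem exists_linearMap_of_isHomogeneous_one {p : MvPolynomial (Fin 4) ℂ}
    (hp : p.IsHomogeneous 1) : ∃ ℓ : (Fin 4 → ℂ) →ₗ[ℂ] ℂ, ∀ x, eval x p = ℓ x := by
  have hp' : p ∈ Submodule.span ℂ (Set.range X) := by
    rw [← homogeneousSubmodule_one_eq_span_X]
    exact hp
  clear hp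
  induction hp' using Submodule.span_induction with
  | mem q hq =>
    obtain ⟨i, rfl⟩ := hq
    exact ⟨LinearMap.proj i, by simp⟩
  | zero => exact ⟨0, by simp⟩
  | add q r _ _ h1 h2 =>
    obtain ⟨ℓ₁, h1⟩ := h1
    obtain ⟨ℓ₂, h2⟩ := h2
    exact ⟨ℓ₁ + ℓ₂, fun x => by simp [h1, h2]⟩
  | smul c q _ h =>
    obtain ⟨ℓ, h⟩ := h
    exact ⟨c • ℓ, fun x => by simp [h]⟩

theorem IsInverse.exists_evalAt_ne_zero {f : Coeffs} {ψ : Fin 3 → Fin 2 → MvPolynomial (Fin 4) ℂ}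
    (h : IsInverse f ψ) (k : Fin 3) : ∃ j s t u, eval (evalAt f ![s, t, u]) (ψ k j) ≠ 0 := by
  obtain ⟨j, hj⟩ := h.left_defined k
  by_contra hcon
  push Not at hcon
  refine hj (MvPolynomial.funext fun v => ?_)
  have := eval_aeval_form f ![fun i => v (0, i), fun i => v (1, i), fun i => v (2, i)] (ψ k j)
  rw [hcon] at this
  rw [map_zero, ← this]
  congr 2
  funext ⟨a, b⟩
  fin_cases a <;> rfl

theorem IsInverse.eval_evalAt {f : Coeffs} {ψ : Fin 3 → Fin 2 → MvPolynomial (Fin 4) ℂ}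
    (h : IsInverse f ψ) (k : Fin 3) (y : Fin 3 → Fin 2 → ℂ) :
    eval (evalAt f y) (ψ k 0) * y k 1 = eval (evalAt f y) (ψ k 1) * y k 0 := by
  have := congrArg (eval fun v => y v.1 v.2) (h.left_eq k)
  rw [map_mul, map_mul, eval_aeval_form, eval_aeval_form, eval_X, eval_X] at this
  exact this

/-- The image of a birational map is Zariski dense. -/
theorem IsInverse.eq_zero_of_forall_eval_evalAt {f : Coeffs}
    {ψ : Fin 3 → Fin 2 → MvPolynomial (Fin 4) ℂ} (h : IsInverse f ψ) {d : ℕ}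
    {p : MvPolynomial (Fin 4) ℂ} (hp : p.IsHomogeneous d) (h0 : ∀ y, eval (evalAt f y) p = 0) :
    p = 0 := by
  obtain ⟨i, hi⟩ := h.right_defined
  set Φ := fun i => aeval (fun v : Fin 3 × Fin 2 => ψ v.1 v.2) (form f i) with hΦ
  have hform : IsForm d fun x => eval x p := ⟨p, hp, fun _ => rfl⟩
  have hzero : p * (Φ i * X i) = 0 := by
    refine MvPolynomial.funext fun x => ?_
    by_contra hne
    rw [map_zero, map_mul, map_mul, eval_X] at hne
    have hpx := left_ne_zero_of_mul hne
    have hΦx := left_ne_zero_of_mul (right_ne_zero_of_mul hne)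
    have hx := right_ne_zero_of_mul (right_ne_zero_of_mul hne)
    have key : evalAt f (fun k j => eval x (ψ k j)) = (eval x (Φ i) / x i) • x := by
      funext j
      have := congrArg (eval x) (h.right_eq i j)
      rw [map_mul, map_mul, eval_X, eval_X] at this
      rw [← eval_aeval_components]
      simp only [Pi.smul_apply, smul_eq_mul]
      field_simp
      exact this.symm
    have := h0 fun k j => eval x (ψ k j)
    rw [key] at this
    exact hpx ((hform.eq_zero_iff_smul (div_ne_zero hΦx hx) x).1 this)
  exact (mul_eq_zero.1 hzero).resolve_right (mul_ne_zero hi (X_ne_zero i))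

theorem exists_equiv_of_ne_zero {α : Fin 2 → ℂ} (hα : α ≠ 0) :
    ∃ (S : (Fin 2 → ℂ) ≃ₗ[ℂ] (Fin 2 → ℂ)) (β : Fin 2 → ℂ), ∀ s,
      S s 0 = α 0 * s 0 + α 1 * s 1 ∧ S s 1 = β 0 * s 0 + β 1 * s 1 := by
  obtain ⟨β, hβ⟩ : ∃ β : Fin 2 → ℂ, α 0 * β 1 - α 1 * β 0 ≠ 0 := by
    by_cases h0 : α 0 = 0
    · refine ⟨![1, 0], ?_⟩
      have h1 : α 1 ≠ 0 := fun h1 => hα (by funext i; fin_cases i <;> assumption)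
      simpa using h1
    · exact ⟨![0, 1], by simpa using h0⟩
  let S : (Fin 2 → ℂ) →ₗ[ℂ] (Fin 2 → ℂ) :=
    { toFun s := ![α 0 * s 0 + α 1 * s 1, β 0 * s 0 + β 1 * s 1]
      map_add' _ _ := by funext j; fin_cases j <;> simp <;> ring
      map_smul' _ _ := by funext j; fin_cases j <;> simp <;> ring }
  have hS : Function.Injective S := by
    rw [← LinearMap.ker_eq_bot, LinearMap.ker_eq_bot']
    intro s hs
    have h0 : α 0 * s 0 + α 1 * s 1 = 0 := congrFun hs 0
    have h1 : β 0 * s 0 + β 1 * s 1 = 0 := congrFun hs 1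
    have e0 : (α 0 * β 1 - α 1 * β 0) * s 0 = 0 := by linear_combination β 1 * h0 - α 1 * h1
    have e1 : (α 0 * β 1 - α 1 * β 0) * s 1 = 0 := by linear_combination α 0 * h1 - β 0 * h0
    funext i
    fin_cases i
    · simpa [hβ] using e0
    · simpa [hβ] using e1
  exact ⟨LinearEquiv.ofInjectiveEndo S hS, β, fun s => ⟨rfl, rfl⟩⟩

theorem exists_equiv_of_linearIndependent {ρ : Fin 3 → (Fin 4 → ℂ) →ₗ[ℂ] ℂ}
    (hρ : LinearIndependent ℂ ρ) : ∃ E : (Fin 4 → ℂ) ≃ₗ[ℂ] (Fin 4 → ℂ),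
      ∀ x, E x 0 = ρ 0 x ∧ E x 1 = ρ 1 x ∧ E x 2 = ρ 2 x := by
  have hdim : Module.finrank ℂ ((Fin 4 → ℂ) →ₗ[ℂ] ℂ) = 4 := by simp
  obtain ⟨ω, hω⟩ : ∃ ω, ω ∉ Submodule.span ℂ (Set.range ρ) := by
    by_contra hcon
    push Not at hcon
    have h1 := finrank_span_eq_card hρ
    rw [(Submodule.eq_top_iff').2 hcon, finrank_top, hdim] at h1
    simp at h1
  have hli : LinearIndependent ℂ (Fin.snoc ρ ω : Fin 4 → (Fin 4 → ℂ) →ₗ[ℂ] ℂ) :=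
    linearIndependent_finSnoc.2 ⟨hρ, hω⟩
  have hspan := hli.span_eq_top_of_card_eq_finrank' (by simp)
  have hinj : Function.Injective
      (LinearMap.pi (Fin.snoc ρ ω : Fin 4 → (Fin 4 → ℂ) →ₗ[ℂ] ℂ)) := by
    rw [← LinearMap.ker_eq_bot, LinearMap.ker_eq_bot']
    intro x hx
    have hle : Submodule.span ℂ (Set.range (Fin.snoc ρ ω : Fin 4 → (Fin 4 → ℂ) →ₗ[ℂ] ℂ)) ≤
        LinearMap.ker (LinearMap.applyₗ x) := by
      rw [Submodule.span_le]
      rintro _ ⟨i, rfl⟩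
      exact congrFun hx i
    rw [hspan] at hle
    funext i
    exact hle (x := LinearMap.proj i) trivial
  exact ⟨LinearEquiv.ofInjectiveEndo _ hinj, fun x => ⟨rfl, rfl, rfl⟩⟩

/-- In the coordinates `E` of the target, `S` and `T` of the first two factors, the first three
components of `f` are `s₀t₀L(u)`, `s₁t₀L(u)` and `s₀t₁L(u)`. -/
structure IsReduced (f : Coeffs) (E : (Fin 4 → ℂ) ≃ₗ[ℂ] (Fin 4 → ℂ))
    (S T : (Fin 2 → ℂ) ≃ₗ[ℂ] (Fin 2 → ℂ)) (L : (Fin 2 → ℂ) →ₗ[ℂ] ℂ) : Prop where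
  zero : ∀ s t u, E (evalAt f ![s, t, u]) 0 = S s 0 * T t 0 * L u
  one : ∀ s t u, E (evalAt f ![s, t, u]) 1 = S s 1 * T t 0 * L u
  two : ∀ s t u, E (evalAt f ![s, t, u]) 2 = S s 0 * T t 1 * L u

/-- If the linear forms that recover `s` and those that recover `t` are dependent, then `f` can be
reduced. -/
theorem exists_isReduced_of_dependent {f : Coeffs} {σ τ : Fin 2 → (Fin 4 → ℂ) →ₗ[ℂ] ℂ}
    (hσ : ∀ s t u, σ 0 (evalAt f ![s, t, u]) * s 1 = σ 1 (evalAt f ![s, t, u]) * s 0)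
    (hσ0 : ∃ j s t u, σ j (evalAt f ![s, t, u]) ≠ 0)
    (hτ : ∀ s t u, τ 0 (evalAt f ![s, t, u]) * t 1 = τ 1 (evalAt f ![s, t, u]) * t 0)
    (hτ0 : ∃ j s t u, τ j (evalAt f ![s, t, u]) ≠ 0) {α β : Fin 2 → ℂ} (hαβ : α ≠ 0 ∨ β ≠ 0)
    (hdep : α 0 • σ 0 + α 1 • σ 1 = β 0 • τ 0 + β 1 • τ 1) :
    ∃ E S T L, L ≠ 0 ∧ IsReduced f E S T L := by
  obtain ⟨j, s₁, t₁, u₁, hg⟩ := hσ0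
  obtain ⟨j', s₂, t₂, u₂, hh⟩ := hτ0
  rw [apply_evalAt_fst hσ] at hg
  rw [apply_evalAt_snd hτ] at hh
  replace hg := right_ne_zero_of_mul hg
  replace hh := right_ne_zero_of_mul hh
  have hρ : ∀ s t u, (α 0 * s 0 + α 1 * s 1) * σ 0 (evalAt f ![![1, 0], t, u]) =
      (β 0 * t 0 + β 1 * t 1) * τ 0 (evalAt f ![s, ![1, 0], u]) := fun s t u => by
    have := LinearMap.congr_fun hdep (evalAt f ![s, t, u])
    simp only [LinearMap.add_apply, LinearMap.smul_apply, smul_eq_mul] at this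
    rw [apply_evalAt_fst hσ 0, apply_evalAt_fst hσ 1, apply_evalAt_snd hτ 0,
      apply_evalAt_snd hτ 1] at this
    linear_combination this
  have hβα : β = 0 → α = 0 := by
    rintro rfl
    have h1 := hρ ![1, 0] t₁ u₁
    have h2 := hρ ![0, 1] t₁ u₁
    simp [hg] at h1 h2
    funext i; fin_cases i <;> assumption
  have hαβ' : α = 0 → β = 0 := by
    rintro rfl
    have h1 := hρ s₂ ![1, 0] u₂
    have h2 := hρ s₂ ![0, 1] u₂
    simp [hh] at h1 h2
    funext i; fin_cases i <;> assumption
  have hα : α ≠ 0 := fun h => hαβ.elim (fun h' => h' h) fun h' => h' (hαβ' h)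
  have hβ : β ≠ 0 := fun h => hα (hβα h)
  obtain ⟨S, α', hS⟩ := exists_equiv_of_ne_zero hα
  obtain ⟨T, β', hT⟩ := exists_equiv_of_ne_zero hβ
  let L : (Fin 2 → ℂ) →ₗ[ℂ] ℂ := τ 0 ∘ₗ uLine f (S.symm ![1, 0]) ![1, 0]
  have hgL : ∀ t u, σ 0 (evalAt f ![![1, 0], t, u]) = T t 0 * L u := fun t u => by
    have := hρ (S.symm ![1, 0]) t u
    rw [← (hS _).1, ← (hT _).1, S.apply_symm_apply] at this
    simpa [L, uLine_apply] using this
  have hhL : ∀ s u, τ 0 (evalAt f ![s, ![1, 0], u]) = S s 0 * L u := fun s u => by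
    have := hρ s (T.symm ![1, 0]) u
    rw [← (hS _).1, ← (hT _).1, hgL, T.apply_symm_apply] at this
    simpa using this.symm
  have hL : L ≠ 0 := fun h => hg (by rw [hgL, h]; simp)
  let ρ : Fin 3 → (Fin 4 → ℂ) →ₗ[ℂ] ℂ := ![α 0 • σ 0 + α 1 • σ 1, α' 0 • σ 0 + α' 1 • σ 1,
    β' 0 • τ 0 + β' 1 • τ 1]
  have h0 : ∀ s t u, ρ 0 (evalAt f ![s, t, u]) = S s 0 * T t 0 * L u := fun s t u => by
    simp only [ρ, Matrix.cons_val, LinearMap.add_apply, LinearMap.smul_apply, smul_eq_mul]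
    rw [apply_evalAt_fst hσ 0, apply_evalAt_fst hσ 1, hgL, (hS s).1]
    ring
  have h1 : ∀ s t u, ρ 1 (evalAt f ![s, t, u]) = S s 1 * T t 0 * L u := fun s t u => by
    simp only [ρ, Matrix.cons_val, LinearMap.add_apply, LinearMap.smul_apply, smul_eq_mul]
    rw [apply_evalAt_fst hσ 0, apply_evalAt_fst hσ 1, hgL, (hS s).2]
    ring
  have h2 : ∀ s t u, ρ 2 (evalAt f ![s, t, u]) = S s 0 * T t 1 * L u := fun s t u => by
    simp only [ρ, Matrix.cons_val, LinearMap.add_apply, LinearMap.smul_apply, smul_eq_mul]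
    rw [apply_evalAt_snd hτ 0, apply_evalAt_snd hτ 1, hhL, (hT t).2]
    ring
  have hli : LinearIndependent ℂ ρ := by
    obtain ⟨u, hu⟩ : ∃ u, L u ≠ 0 := by
      by_contra hcon
      push Not at hcon
      exact hL (LinearMap.ext hcon)
    rw [Fintype.linearIndependent_iff]
    intro c hc
    have key : ∀ s t, c 0 * (S s 0 * T t 0) + c 1 * (S s 1 * T t 0) + c 2 * (S s 0 * T t 1) = 0 :=
      fun s t => by
        have := LinearMap.congr_fun hc (evalAt f ![s, t, u])
        simp only [Fin.sum_univ_three, LinearMap.add_apply, LinearMap.smul_apply, h0, h1, h2,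
          smul_eq_mul, LinearMap.zero_apply] at this
        apply mul_right_cancel₀ hu
        linear_combination this
    have k0 := key (S.symm ![1, 0]) (T.symm ![1, 0])
    have k1 := key (S.symm ![0, 1]) (T.symm ![1, 0])
    have k2 := key (S.symm ![1, 0]) (T.symm ![0, 1])
    simp at k0 k1 k2
    intro i; fin_cases i <;> assumption
  obtain ⟨E, hE⟩ := exists_equiv_of_linearIndependent hli
  exact ⟨E, S, T, L, hL, fun s t u => by rw [(hE _).1, h0], fun s t u => by rw [(hE _).2.1, h1],
    fun s t u => by rw [(hE _).2.2, h2]⟩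

theorem right_eq_zero_of_isRelPrime {p q m n : MvPolynomial (Fin 4) ℂ} (hp : p.IsHomogeneous 2)
    (hpq : IsRelPrime p q) (hn : n.IsHomogeneous 1) (h : p * m + q * n = 0) : n = 0 := by
  by_contra hn0
  have hdvd : p ∣ q * n := ⟨-m, by linear_combination h⟩
  obtain ⟨r, rfl⟩ := hpq.dvd_of_dvd_mul_left hdvd
  have hp0 := left_ne_zero_of_mul hn0
  have hdeg := hn.totalDegree hn0
  rw [totalDegree_mul_of_isDomain hp0 (right_ne_zero_of_mul hn0), hp.totalDegree hp0] at hdeg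
  omega

/-- If the linear forms that recover `s` and those that recover `t` were independent, then `u`
would be recovered by linear forms as well, which is impossible if it is recovered by coprime
quadratic forms. -/
theorem IsInverse.exists_dependence {f : Coeffs} {ψ : Fin 3 → Fin 2 → MvPolynomial (Fin 4) ℂ}
    (hf : IsInverse f ψ) (h2 : ∀ j, (ψ 2 j).IsHomogeneous 2) (hrel : IsRelPrime (ψ 2 0) (ψ 2 1))
    {σ τ : Fin 2 → (Fin 4 → ℂ) →ₗ[ℂ] ℂ}
    (hσ : ∀ s t u, σ 0 (evalAt f ![s, t, u]) * s 1 = σ 1 (evalAt f ![s, t, u]) * s 0)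
    (hσ0 : ∃ j s t u, σ j (evalAt f ![s, t, u]) ≠ 0)
    (hτ : ∀ s t u, τ 0 (evalAt f ![s, t, u]) * t 1 = τ 1 (evalAt f ![s, t, u]) * t 0) :
    ∃ α β : Fin 2 → ℂ, (α ≠ 0 ∨ β ≠ 0) ∧
      α 0 • σ 0 + α 1 • σ 1 = β 0 • τ 0 + β 1 • τ 1 := by
  obtain ⟨j, s₁, t₁, u₁, hg⟩ := hσ0
  rw [apply_evalAt_fst hσ] at hg
  replace hg := right_ne_zero_of_mul hg
  let e : Fin 2 → Fin 2 → ℂ := ![![1, 0], ![0, 1]]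
  have he0 : e 0 = ![1, 0] := rfl
  have he1 : e 1 = ![0, 1] := rfl
  let G : (Fin 2 → ℂ) → (Fin 2 → ℂ) → ℂ := fun t u => σ 0 (evalAt f ![![1, 0], t, u])
  let H : (Fin 2 → ℂ) → (Fin 2 → ℂ) → ℂ := fun s u => τ 0 (evalAt f ![s, ![1, 0], u])
  have hG : ∀ t u, G t u = t 0 * (u 0 * G (e 0) (e 0) + u 1 * G (e 0) (e 1)) +
      t 1 * (u 0 * G (e 1) (e 0) + u 1 * G (e 1) (e 1)) := fun t u => by
    simp only [G]
    conv_lhs => rw [eq_combination t, eq_combination u]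
    simp only [evalAt_snd, evalAt_trd, map_add, map_smul, smul_eq_mul, he0, he1]
    ring
  have hH : ∀ s u, H s u = s 0 * (u 0 * H (e 0) (e 0) + u 1 * H (e 0) (e 1)) +
      s 1 * (u 0 * H (e 1) (e 0) + u 1 * H (e 1) (e 1)) := fun s u => by
    simp only [H]
    conv_lhs => rw [eq_combination s, eq_combination u]
    simp only [evalAt_fst, evalAt_trd, map_add, map_smul, smul_eq_mul, he0, he1]
    ring
  let N : Fin 2 → (Fin 4 → ℂ) →ₗ[ℂ] ℂ := fun l =>
    (H (e 0) (e l) • σ 0 + H (e 1) (e l) • σ 1) - (G (e 0) (e l) • τ 0 + G (e 1) (e l) • τ 1)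
  have hN : ∀ s t u, u 0 * N 0 (evalAt f ![s, t, u]) + u 1 * N 1 (evalAt f ![s, t, u]) = 0 := by
    intro s t u
    simp only [N, LinearMap.add_apply, LinearMap.sub_apply, LinearMap.smul_apply, smul_eq_mul]
    rw [apply_evalAt_fst hσ 0, apply_evalAt_fst hσ 1, apply_evalAt_snd hτ 0,
      apply_evalAt_snd hτ 1]
    change u 0 * (H _ _ * (s 0 * G t u) + H _ _ * (s 1 * G t u) -
      (G _ _ * (t 0 * H s u) + G _ _ * (t 1 * H s u))) +
      u 1 * (H _ _ * (s 0 * G t u) + H _ _ * (s 1 * G t u) -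
      (G _ _ * (t 0 * H s u) + G _ _ * (t 1 * H s u))) = 0
    linear_combination H s u * hG t u - G t u * hH s u
  choose n hn hnN using fun l => IsForm.linear (N l)
  have hsum : ψ 2 0 * n 0 + ψ 2 1 * n 1 = 0 := by
    refine hf.eq_zero_of_forall_eval_evalAt (((h2 0).mul (hn 0)).add ((h2 1).mul (hn 1)))
      fun y => ?_
    have hy : y = ![y 0, y 1, y 2] := by funext k; fin_cases k <;> rfl
    have hNy := hN (y 0) (y 1) (y 2)
    rw [← hy] at hNy
    have hψy := hf.eval_evalAt 2 y
    simp only [map_add, map_mul, hnN]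
    by_cases hu : y 2 = 0
    · have : evalAt f y = 0 := by
        funext i
        simp [evalAt_apply, hu]
      simp [this]
    · have h0 : y 2 0 * (eval (evalAt f y) (ψ 2 0) * N 0 (evalAt f y) +
          eval (evalAt f y) (ψ 2 1) * N 1 (evalAt f y)) = 0 := by
        linear_combination eval (evalAt f y) (ψ 2 0) * hNy - N 1 (evalAt f y) * hψy
      have h1 : y 2 1 * (eval (evalAt f y) (ψ 2 0) * N 0 (evalAt f y) +
          eval (evalAt f y) (ψ 2 1) * N 1 (evalAt f y)) = 0 := by
        linear_combination eval (evalAt f y) (ψ 2 1) * hNy + N 0 (evalAt f y) * hψy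
      by_contra hne
      exact hu (by
        funext i
        fin_cases i
        · exact (mul_eq_zero.1 h0).resolve_right hne
        · exact (mul_eq_zero.1 h1).resolve_right hne)
  have hn1 : n 1 = 0 := right_eq_zero_of_isRelPrime (h2 0) hrel (hn 1) hsum
  have hn0 : n 0 = 0 :=
    right_eq_zero_of_isRelPrime (h2 1) hrel.symm (hn 0) (by rw [add_comm]; exact hsum)
  have hN0 : ∀ l, N l = 0 := by
    intro l
    have hnl : n l = 0 := by fin_cases l <;> assumption
    refine LinearMap.ext fun x => ?_
    exact (hnN l x).symm.trans (by rw [hnl, map_zero, LinearMap.zero_apply])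
  by_contra hcon
  push Not at hcon
  have key : ∀ l, G (e 0) (e l) = 0 ∧ G (e 1) (e l) = 0 := by
    intro l
    by_contra hne
    refine hcon ![H (e 0) (e l), H (e 1) (e l)] ![G (e 0) (e l), G (e 1) (e l)]
      (Or.inr fun h => hne ⟨congrFun h 0, congrFun h 1⟩) ?_
    exact sub_eq_zero.1 (hN0 l)
  apply hg
  change G t₁ u₁ = 0
  rw [hG, (key 0).1, (key 0).2, (key 1).1, (key 1).2]
  ring

theorem IsBirationalOfType.exists_isReduced {f : Coeffs} (hf : IsBirationalOfType f ![1, 1, 2]) :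
    ∃ E S T L, L ≠ 0 ∧ IsReduced f E S T L := by
  obtain ⟨-, ψ, hhom, hrel, hinv⟩ := hf
  choose σ hσ using fun j => exists_linearMap_of_isHomogeneous_one (hhom 0 j)
  choose τ hτ using fun j => exists_linearMap_of_isHomogeneous_one (hhom 1 j)
  have hσ' : ∀ s t u, σ 0 (evalAt f ![s, t, u]) * s 1 = σ 1 (evalAt f ![s, t, u]) * s 0 :=
    fun s t u => by
      rw [← hσ, ← hσ]
      exact hinv.eval_evalAt 0 ![s, t, u]
  have hτ' : ∀ s t u, τ 0 (evalAt f ![s, t, u]) * t 1 = τ 1 (evalAt f ![s, t, u]) * t 0 :=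
    fun s t u => by
      rw [← hτ, ← hτ]
      exact hinv.eval_evalAt 1 ![s, t, u]
  have hσ0 := hinv.exists_evalAt_ne_zero 0
  have hτ0 := hinv.exists_evalAt_ne_zero 1
  simp only [hσ] at hσ0
  simp only [hτ] at hτ0
  obtain ⟨α, β, hαβ, hdep⟩ := hinv.exists_dependence (hhom 2) (hrel 2) hσ' hσ0 hτ'
  exact exists_isReduced_of_dependent hσ' hσ0 hτ' hτ0 hαβ hdep

section

/-! ### The open condition -/

theorem IsForm.det {ι : Type} {n : ℕ} {g : Fin n → Fin n → (ι → ℂ) → ℂ}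
    (hg : ∀ i j, IsForm 1 (g i j)) :
    IsForm n (fun x => Matrix.det (Matrix.of fun i j => g i j x)) := by
  choose q hq hqg using hg
  refine ⟨Matrix.det (Matrix.of q), ?_, fun x => ?_⟩
  · rw [Matrix.det_apply]
    refine IsHomogeneous.sum _ _ _ fun σ _ => ?_
    rw [Units.smul_def, zsmul_eq_mul, ← map_intCast (C : ℂ →+* MvPolynomial ι ℂ)]
    refine IsHomogeneous.C_mul ?_ _
    have := IsHomogeneous.prod Finset.univ (fun i => Matrix.of q (σ i) i) (fun _ => 1)
      fun i _ => hq (σ i) i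
    simpa using this
  · rw [RingHom.map_det]
    congr 1
    ext i j
    simp [hqg]

theorem isForm_evalAt (y : Fin 3 → Fin 2 → ℂ) (i : Fin 4) :
    IsForm 1 (fun f : Coeffs => evalAt f y i) := by
  have : (fun f : Coeffs => evalAt f y i) = fun f => ∑ j : Fin 2, ∑ k : Fin 2, ∑ l : Fin 2,
      (y 0 j * y 1 k * y 2 l) * f (i, j, k, l) := by
    funext f
    rw [evalAt_apply]
    refine Finset.sum_congr rfl fun j _ => Finset.sum_congr rfl fun k _ =>
      Finset.sum_congr rfl fun l _ => ?_
    ring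
  rw [this]
  exact IsForm.sum _ fun j _ => IsForm.sum _ fun k _ => IsForm.sum _ fun l _ =>
    (IsForm.coord _).const_mul _

/-- For fixed `u`, the determinant of the coefficients of the bilinear map `f(·, ·, u)`. -/
def uDet (f : Coeffs) (u : Fin 2 → ℂ) : ℂ :=
  Matrix.det (Matrix.of fun i j => ![evalAt f ![![1, 0], ![1, 0], u],
    evalAt f ![![0, 1], ![1, 0], u], evalAt f ![![1, 0], ![0, 1], u],
    evalAt f ![![0, 1], ![0, 1], u]] i j)

/-- For fixed `u`, the determinant of the bilinear form `ℓ ∘ f(·, ·, u)`. -/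
def uDisc (ℓ : (Fin 4 → ℂ) →ₗ[ℂ] ℂ) (f : Coeffs) (u : Fin 2 → ℂ) : ℂ :=
  ℓ (evalAt f ![![1, 0], ![1, 0], u]) * ℓ (evalAt f ![![0, 1], ![0, 1], u]) -
    ℓ (evalAt f ![![0, 1], ![1, 0], u]) * ℓ (evalAt f ![![1, 0], ![0, 1], u])

theorem isForm_uDet (u : Fin 2 → ℂ) : IsForm 4 (fun f => uDet f u) :=
  IsForm.det fun i j => by fin_cases i <;> exact isForm_evalAt _ j

theorem isForm_uDisc (ℓ : (Fin 4 → ℂ) →ₗ[ℂ] ℂ) (u : Fin 2 → ℂ) :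
    IsForm 2 (fun f => uDisc ℓ f u) := by
  have h : ∀ y, IsForm 1 (fun f : Coeffs => ℓ (evalAt f y)) := fun y =>
    (IsForm.linear ℓ).comp (isForm_evalAt y)
  exact ((h _).mul (h _)).sub ((h _).mul (h _))

/-- A covariant of a binary quartic `D` that vanishes on fourth powers of linear forms. If
`D = l³ m`, then it is proportional to the product of the squares of `l u`, `l v` and the
determinants of `l`, `m` and of `u`, `v`. -/
def quarticCovariant (D : (Fin 2 → ℂ) → ℂ) (u v : Fin 2 → ℂ) : ℂ :=
  ((D (u + v) + D (u - v) - 2 * D u - 2 * D v) / 12) ^ 2 - D u * D v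

/-- A form in the coefficients of `f` that distinguishes the general maps of type `(1, 1, 2)`. For
these, `uDet f` has a threefold linear factor `L`, and `genericity` is, up to factors that are
nonzero for general `u` and `v`, the value of `uDisc ℓ f` at the root of `L` (see
`IsReduced.exists_genericity_eq`). -/
def genericity (ℓ : (Fin 4 → ℂ) →ₗ[ℂ] ℂ) (u v : Fin 2 → ℂ) (f : Coeffs) : ℂ :=
  uDisc ℓ f u * quarticCovariant (uDet f) u v -
    (uDisc ℓ f (u + v) - uDisc ℓ f u - uDisc ℓ f v) *
      ((quarticCovariant (uDet f) u (u + v) - quarticCovariant (uDet f) u (u - v)) / 4) +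
    uDisc ℓ f v * ((quarticCovariant (uDet f) u (u + v) + quarticCovariant (uDet f) u (u - v)) / 2 -
      quarticCovariant (uDet f) u v)

theorem isForm_quarticCovariant (u v : Fin 2 → ℂ) :
    IsForm 8 (fun f => quarticCovariant (uDet f) u v) := by
  have h : IsForm 4 fun f => (1 / 12 : ℂ) * (uDet f (u + v) + uDet f (u - v) - 2 * uDet f u -
      2 * uDet f v) :=
    (((((isForm_uDet _).add (isForm_uDet _)).sub ((isForm_uDet _).const_mul 2)).sub
      ((isForm_uDet _).const_mul 2))).const_mul _
  convert (h.pow 2).sub ((isForm_uDet u).mul (isForm_uDet v)) using 2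
  simp only [quarticCovariant]
  ring

theorem isForm_genericity (ℓ : (Fin 4 → ℂ) →ₗ[ℂ] ℂ) (u v : Fin 2 → ℂ) :
    IsForm 10 (genericity ℓ u v) := by
  have hd := isForm_uDisc ℓ
  have hq := isForm_quarticCovariant
  convert (((hd u).mul (hq u v)).sub
    ((((hd (u + v)).sub (hd u)).sub (hd v)).mul
      (((hq u (u + v)).sub (hq u (u - v))).const_mul (1 / 4)))).add
    ((hd v).mul ((((hq u (u + v)).add (hq u (u - v))).const_mul (1 / 2)).sub (hq u v))) using 2
  simp only [genericity]
  ring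

variable {f : Coeffs} {E : (Fin 4 → ℂ) ≃ₗ[ℂ] (Fin 4 → ℂ)}
  {S T : (Fin 2 → ℂ) ≃ₗ[ℂ] (Fin 2 → ℂ)} {L : (Fin 2 → ℂ) →ₗ[ℂ] ℂ}

/-- The coefficients of the last component of `f` as a bilinear form in `S s` and `T t`; they are
linear forms in `u`. -/
def lastCoeff (f : Coeffs) (E : (Fin 4 → ℂ) ≃ₗ[ℂ] (Fin 4 → ℂ))
    (S T : (Fin 2 → ℂ) ≃ₗ[ℂ] (Fin 2 → ℂ)) (a b : Fin 2) : (Fin 2 → ℂ) →ₗ[ℂ] ℂ :=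
  coordinate E 3 ∘ₗ uLine f (S.symm (![![1, 0], ![0, 1]] a)) (T.symm (![![1, 0], ![0, 1]] b))

theorem apply_evalAt_three (f : Coeffs) (E : (Fin 4 → ℂ) ≃ₗ[ℂ] (Fin 4 → ℂ))
    (S T : (Fin 2 → ℂ) ≃ₗ[ℂ] (Fin 2 → ℂ)) (s t u : Fin 2 → ℂ) :
    E (evalAt f ![s, t, u]) 3 =
      S s 0 * T t 0 * lastCoeff f E S T 0 0 u + S s 1 * T t 0 * lastCoeff f E S T 1 0 u +
      S s 0 * T t 1 * lastCoeff f E S T 0 1 u + S s 1 * T t 1 * lastCoeff f E S T 1 1 u := by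
  have hs : s = S s 0 • S.symm ![1, 0] + S s 1 • S.symm ![0, 1] := by
    rw [← map_smul, ← map_smul, ← map_add, ← eq_combination, S.symm_apply_apply]
  have ht : t = T t 0 • T.symm ![1, 0] + T t 1 • T.symm ![0, 1] := by
    rw [← map_smul, ← map_smul, ← map_add, ← eq_combination, T.symm_apply_apply]
  conv_lhs => rw [hs, ht]
  simp only [evalAt_fst, evalAt_snd, map_add, map_smul, lastCoeff, LinearMap.comp_apply,
    coordinate_apply, uLine_apply, Pi.add_apply, Pi.smul_apply, smul_eq_mul, Matrix.cons_val]
  ring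

theorem IsReduced.exists_uDet_eq (hf : IsReduced f E S T L) :
    ∃ c : ℂ, c ≠ 0 ∧ ∀ u, uDet f u = c * (L u ^ 3 * lastCoeff f E S T 1 1 u) := by
  have hE : IsUnit (LinearMap.toMatrix' E.toLinearMap).det := by
    rw [LinearMap.det_toMatrix']
    exact LinearEquiv.isUnit_det' E
  have hE0 := hE.ne_zero
  refine ⟨(S ![1, 0] 0 * S ![0, 1] 1 - S ![1, 0] 1 * S ![0, 1] 0) ^ 2 *
    (T ![1, 0] 0 * T ![0, 1] 1 - T ![1, 0] 1 * T ![0, 1] 0) ^ 2 /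
      (LinearMap.toMatrix' E.toLinearMap).det,
    div_ne_zero (mul_ne_zero (pow_ne_zero _ (det_ne_zero_of_equiv S))
      (pow_ne_zero _ (det_ne_zero_of_equiv T))) hE0, fun u => ?_⟩
  rw [div_mul_eq_mul_div, eq_div_iff hE0, uDet, ← Matrix.det_transpose (LinearMap.toMatrix' _),
    ← Matrix.det_mul]
  have hrow : ∀ s t, (fun j => E (evalAt f ![s, t, u]) j) =
      ![S s 0 * T t 0 * L u, S s 1 * T t 0 * L u, S s 0 * T t 1 * L u,
      S s 0 * T t 0 * lastCoeff f E S T 0 0 u + S s 1 * T t 0 * lastCoeff f E S T 1 0 u +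
      S s 0 * T t 1 * lastCoeff f E S T 0 1 u + S s 1 * T t 1 * lastCoeff f E S T 1 1 u] := by
    intro s t
    funext j
    fin_cases j
    exacts [hf.zero s t u, hf.one s t u, hf.two s t u, apply_evalAt_three f E S T s t u]
  have hmul : ∀ (r : Fin 4 → Fin 4 → ℂ) (i j : Fin 4),
      ((Matrix.of fun i j => r i j) * (LinearMap.toMatrix' E.toLinearMap).transpose) i j =
        E (r i) j := fun r i j => by
    have := congrFun (LinearMap.toMatrix'_mulVec E.toLinearMap (r i)) j
    rw [LinearEquiv.coe_coe] at this
    rw [← this, Matrix.mul_apply, Matrix.mulVec, dotProduct]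
    refine Finset.sum_congr rfl fun k _ => ?_
    rw [Matrix.transpose_apply, mul_comm]
    rfl
  have hrow' := fun s t j => congrFun (hrow s t) j
  simp only [Matrix.det_succ_row_zero, Fin.sum_univ_succ, hmul, Matrix.submatrix_apply]
  simp [Fin.succAbove, hrow']
  ring

theorem IsReduced.uDisc_eq (hf : IsReduced f E S T L) (ℓ : (Fin 4 → ℂ) →ₗ[ℂ] ℂ) {u : Fin 2 → ℂ}
    (hu : L u = 0) : uDisc ℓ f u = ℓ (E.symm (Pi.single 3 1)) ^ 2 *
      ((S ![1, 0] 0 * S ![0, 1] 1 - S ![1, 0] 1 * S ![0, 1] 0) *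
      (T ![1, 0] 0 * T ![0, 1] 1 - T ![1, 0] 1 * T ![0, 1] 0)) *
      (lastCoeff f E S T 0 0 u * lastCoeff f E S T 1 1 u -
        lastCoeff f E S T 1 0 u * lastCoeff f E S T 0 1 u) := by
  have h : ∀ s t, ℓ (evalAt f ![s, t, u]) =
      E (evalAt f ![s, t, u]) 3 * ℓ (E.symm (Pi.single 3 1)) := fun s t => by
    rw [← smul_eq_mul, ← map_smul, ← map_smul, ← E.symm_apply_apply (evalAt f ![s, t, u])]
    congr 2
    funext j
    rw [E.apply_symm_apply]
    fin_cases j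
    · simp [hf.zero, hu]
    · simp [hf.one, hu]
    · simp [hf.two, hu]
    · simp
  simp only [uDisc, h, apply_evalAt_three f E S T]
  ring

theorem uDisc_combination (ℓ : (Fin 4 → ℂ) →ₗ[ℂ] ℂ) (f : Coeffs) (a b : ℂ) (u v : Fin 2 → ℂ) :
    uDisc ℓ f (a • u + b • v) = a ^ 2 * uDisc ℓ f u +
      a * b * (uDisc ℓ f (u + v) - uDisc ℓ f u - uDisc ℓ f v) + b ^ 2 * uDisc ℓ f v := by
  have h := fun s t => evalAt_trd f 1 1 s t u v
  simp only [one_smul] at h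
  simp only [uDisc, evalAt_trd, h, map_add, map_smul, smul_eq_mul]
  ring

theorem IsReduced.exists_genericity_eq (hf : IsReduced f E S T L) : ∃ c : ℂ, c ≠ 0 ∧
    ∀ (ℓ : (Fin 4 → ℂ) →ₗ[ℂ] ℂ) (u v : Fin 2 → ℂ), genericity ℓ u v f =
      c * (L u * lastCoeff f E S T 1 1 v - L v * lastCoeff f E S T 1 1 u) ^ 2 * L u ^ 2 *
        uDisc ℓ f (L v • u - L u • v) := by
  obtain ⟨c, hc, hD⟩ := hf.exists_uDet_eq
  refine ⟨c ^ 2 / 4, by simpa using hc, fun ℓ u v => ?_⟩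
  have h := uDisc_combination ℓ f (L v) (-L u) u v
  rw [neg_smul, ← sub_eq_add_neg] at h
  rw [h]
  simp only [genericity, quarticCovariant, hD, map_add, map_sub]
  ring

/-- A reduced map is generic if its last component restricts at the root of `L` to a nondegenerate
bilinear form in `s` and `t` with nonzero coefficient of `S s 1 * T t 1`. -/
def IsGeneric (f : Coeffs) (E : (Fin 4 → ℂ) ≃ₗ[ℂ] (Fin 4 → ℂ))
    (S T : (Fin 2 → ℂ) ≃ₗ[ℂ] (Fin 2 → ℂ)) (L : (Fin 2 → ℂ) →ₗ[ℂ] ℂ) : Prop :=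
  ∃ u, L u = 0 ∧ lastCoeff f E S T 1 1 u ≠ 0 ∧ lastCoeff f E S T 0 0 u * lastCoeff f E S T 1 1 u -
    lastCoeff f E S T 1 0 u * lastCoeff f E S T 0 1 u ≠ 0

theorem IsReduced.isGeneric_of_genericity_ne_zero (hf : IsReduced f E S T L)
    {ℓ : (Fin 4 → ℂ) →ₗ[ℂ] ℂ} {u v : Fin 2 → ℂ} (h : genericity ℓ u v f ≠ 0) :
    IsGeneric f E S T L := by
  obtain ⟨c, hc, he⟩ := hf.exists_genericity_eq
  rw [he] at h
  have hu : L (L v • u - L u • v) = 0 := by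
    simp only [map_sub, map_smul, smul_eq_mul]
    ring
  have h1 := right_ne_zero_of_mul h
  have h2 := right_ne_zero_of_mul (left_ne_zero_of_mul (left_ne_zero_of_mul h))
  rw [hf.uDisc_eq ℓ hu] at h1
  refine ⟨_, hu, ?_, right_ne_zero_of_mul h1⟩
  simp only [map_sub, map_smul, smul_eq_mul]
  intro h0
  apply h2
  rw [pow_eq_zero_iff two_ne_zero]
  linear_combination -h0

theorem IsReduced.exists_genericity_ne_zero (hf : IsReduced f E S T L) (hL : L ≠ 0)
    (hgen : IsGeneric f E S T L) : ∃ ℓ u v, genericity ℓ u v f ≠ 0 := by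
  obtain ⟨c, hc, he⟩ := hf.exists_genericity_eq
  obtain ⟨v, hv0, hv1, hv2⟩ := hgen
  obtain ⟨u, hu⟩ : ∃ u, L u ≠ 0 := by
    by_contra hcon
    push Not at hcon
    exact hL (LinearMap.ext hcon)
  refine ⟨coordinate E 3, u, v, ?_⟩
  have hw : L (L v • u - L u • v) = 0 := by
    simp only [map_sub, map_smul, smul_eq_mul]
    ring
  rw [he, hf.uDisc_eq _ hw]
  simp only [hv0, zero_smul, zero_sub, zero_mul, sub_zero, map_neg, map_smul, smul_eq_mul,
    coordinate_apply, E.apply_symm_apply, Pi.single_eq_same, one_pow, one_mul]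
  have e : ∀ a b c d : ℂ, -(L u * a) * -(L u * b) - -(L u * c) * -(L u * d) =
      L u ^ 2 * (a * b - c * d) := fun a b c d => by ring
  rw [e]
  have hS := det_ne_zero_of_equiv S
  have hT := det_ne_zero_of_equiv T
  positivity

theorem exists_triangular_equiv {a : ℂ} (ha : a ≠ 0) (b : ℂ) :
    ∃ A : (Fin 2 → ℂ) ≃ₗ[ℂ] (Fin 2 → ℂ), ∀ x, A x = ![a * x 0, x 1 + b * x 0] := by
  let A : (Fin 2 → ℂ) →ₗ[ℂ] (Fin 2 → ℂ) :=
    { toFun x := ![a * x 0, x 1 + b * x 0]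
      map_add' _ _ := by funext j; fin_cases j <;> simp <;> ring
      map_smul' _ _ := by funext j; fin_cases j <;> simp <;> ring }
  have hA : Function.Injective A := by
    rw [← LinearMap.ker_eq_bot, LinearMap.ker_eq_bot']
    intro x hx
    have h0 : a * x 0 = 0 := congrFun hx 0
    have h1 : x 1 + b * x 0 = 0 := congrFun hx 1
    have e0 : x 0 = 0 := by simpa [ha] using h0
    have e1 : x 1 = 0 := by simpa [e0] using h1
    funext j; fin_cases j <;> assumption
  exact ⟨LinearEquiv.ofInjectiveEndo A hA, fun x => rfl⟩

theorem exists_triangular_equiv_four {k : ℂ} (hk : k ≠ 0) (a b p q r : ℂ) :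
    ∃ A : (Fin 4 → ℂ) ≃ₗ[ℂ] (Fin 4 → ℂ), ∀ x, A x =
      ![k * x 0, x 1 + a * x 0, k * (x 2 + b * x 0), x 3 - p * x 0 - q * x 1 - r * x 2] := by
  let A : (Fin 4 → ℂ) →ₗ[ℂ] (Fin 4 → ℂ) :=
    { toFun x := ![k * x 0, x 1 + a * x 0, k * (x 2 + b * x 0), x 3 - p * x 0 - q * x 1 - r * x 2]
      map_add' _ _ := by funext j; fin_cases j <;> simp <;> ring
      map_smul' _ _ := by funext j; fin_cases j <;> simp <;> ring }
  have hA : Function.Injective A := by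
    rw [← LinearMap.ker_eq_bot, LinearMap.ker_eq_bot']
    intro x hx
    have h0 : k * x 0 = 0 := congrFun hx 0
    have h1 : x 1 + a * x 0 = 0 := congrFun hx 1
    have h2 : k * (x 2 + b * x 0) = 0 := congrFun hx 2
    have h3 : x 3 - p * x 0 - q * x 1 - r * x 2 = 0 := congrFun hx 3
    have e0 : x 0 = 0 := by simpa [hk] using h0
    have e1 : x 1 = 0 := by simpa [e0] using h1
    have e2 : x 2 = 0 := by simpa [hk, e0] using h2
    have e3 : x 3 = 0 := by simpa [e0, e1, e2] using h3
    funext j; fin_cases j <;> assumption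
  exact ⟨LinearEquiv.ofInjectiveEndo A hA, fun x => rfl⟩

/-- A generic reduced map has the normal form: `L` and the coefficient of `S s 1 * T t 1` serve as
coordinates of the third factor, and completing the bilinear form at the root of `L` to
`s₀t₀ + s₁t₁` changes the coordinates of the first two factors. -/
theorem IsReduced.exists_isNormalForm (hf : IsReduced f E S T L)
    (hgen : IsGeneric f E S T L) (hL : L ≠ 0) : ∃ E' R, IsNormalForm f E' R := by
  obtain ⟨u, hLu, hMu, hdet⟩ := hgen
  set F := lastCoeff f E S T with hF
  have hUinj : Function.Injective (LinearMap.pi ![L, F 1 1]) := by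
    rw [← LinearMap.ker_eq_bot, LinearMap.ker_eq_bot']
    intro v hv
    have h0 : L v = 0 := congrFun hv 0
    have h1 : F 1 1 v = 0 := congrFun hv 1
    obtain ⟨w, hw⟩ : ∃ w, L w ≠ 0 := by
      by_contra hcon
      push Not at hcon
      exact hL (LinearMap.ext hcon)
    -- `u` and `w` are a basis on which `L` and `F 1 1` are triangular.
    have hbasis : u 0 * w 1 - u 1 * w 0 ≠ 0 := by
      intro h
      have e0 : u 0 • w - w 0 • u = 0 := by
        funext j; fin_cases j
        · simp; ring
        · simp; linear_combination h
      have e1 : u 1 • w - w 1 • u = 0 := by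
        funext j; fin_cases j
        · simp; linear_combination -h
        · simp; ring
      have k0 := congrArg L e0
      have k1 := congrArg L e1
      simp [hLu, hw] at k0 k1
      apply hMu
      have : u = 0 := by funext j; fin_cases j <;> assumption
      rw [this, map_zero]
    have hcomb : (u 0 * w 1 - u 1 * w 0) • v =
        (v 0 * w 1 - v 1 * w 0) • u + (u 0 * v 1 - u 1 * v 0) • w := by
      funext j; fin_cases j <;> simp <;> ring
    have k0 := congrArg L hcomb
    simp only [map_smul, map_add, h0, hLu, smul_eq_mul, mul_zero, zero_add] at k0
    have c2 : u 0 * v 1 - u 1 * v 0 = 0 := by simpa [hw] using k0.symm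
    have k1 := congrArg (F 1 1) hcomb
    simp only [map_smul, h1, c2, zero_smul, add_zero, smul_eq_mul, mul_zero] at k1
    have c1 : v 0 * w 1 - v 1 * w 0 = 0 := by simpa [hMu] using k1.symm
    rw [c1, c2, zero_smul, zero_smul, add_zero] at hcomb
    simpa [hbasis] using hcomb
  let U : (Fin 2 → ℂ) ≃ₗ[ℂ] (Fin 2 → ℂ) := LinearEquiv.ofInjectiveEndo _ hUinj
  have hU0 : ∀ v, U v 0 = L v := fun v => rfl
  have hU1 : ∀ v, U v 1 = F 1 1 v := fun v => rfl
  set x := U.symm ![0, 1] with hx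
  set w := U.symm ![1, 0] with hw
  have hLx : L x = 0 := by rw [← hU0, hx, U.apply_symm_apply]; rfl
  have hMx : F 1 1 x = 1 := by rw [← hU1, hx, U.apply_symm_apply]; rfl
  have hMw : F 1 1 w = 0 := by rw [← hU1, hw, U.apply_symm_apply]; rfl
  have hv : ∀ v, v = L v • w + F 1 1 v • x := fun v => by
    rw [hx, hw, ← map_smul, ← map_smul, ← map_add, ← hU0, ← hU1, ← eq_combination,
      U.symm_apply_apply]
  have hFv : ∀ a b v, F a b v = L v * F a b w + F 1 1 v * F a b x := fun a b v => by
    conv_lhs => rw [hv v]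
    simp only [map_add, map_smul, smul_eq_mul]
  have hk : F 0 0 x - F 1 0 x * F 0 1 x ≠ 0 := by
    intro h
    apply hdet
    rw [hFv 0 0 u, hFv 1 0 u, hFv 0 1 u, hLu]
    linear_combination F 1 1 u ^ 2 * h
  obtain ⟨A, hA⟩ := exists_triangular_equiv hk (F 0 1 x)
  obtain ⟨B, hB⟩ := exists_triangular_equiv one_ne_zero (F 1 0 x)
  obtain ⟨D, hD⟩ := exists_triangular_equiv_four hk (F 0 1 x) (F 1 0 x) (F 0 0 w) (F 1 0 w)
    (F 0 1 w)
  refine ⟨E.trans D, ![S.trans A, T.trans B, U], fun y => ?_⟩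
  have hy : y = ![y 0, y 1, y 2] := by funext k; fin_cases k <;> rfl
  have e0 := hf.zero (y 0) (y 1) (y 2)
  have e1 := hf.one (y 0) (y 1) (y 2)
  have e2 := hf.two (y 0) (y 1) (y 2)
  have e3 := apply_evalAt_three f E S T (y 0) (y 1) (y 2)
  rw [← hy] at e0 e1 e2 e3
  rw [← hF, hFv 0 0, hFv 1 0, hFv 0 1] at e3
  rw [LinearEquiv.trans_apply, hD, e0, e1, e2, e3]
  funext j
  fin_cases j <;> simp [normalMap, hA, hB, hU0, hU1] <;> ring

end

section

/-! ### Maps in normal form are birational of type `(1, 1, 2)` -/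

theorem irreducible_of_isHomogeneous_one {ι : Type} {p : MvPolynomial ι ℂ}
    (hp : p.IsHomogeneous 1) (hp0 : p ≠ 0) : Irreducible p := by
  refine irreducible_of_totalDegree_eq_one (hp.totalDegree hp0) fun x hx => ?_
  rw [isUnit_iff_ne_zero]
  rintro rfl
  exact hp0 (MvPolynomial.ext _ _ fun i => by simpa using hx i)

variable {f : Coeffs} {E : (Fin 4 → ℂ) ≃ₗ[ℂ] (Fin 4 → ℂ)}
  {R : Fin 3 → (Fin 2 → ℂ) ≃ₗ[ℂ] (Fin 2 → ℂ)}

theorem IsNormalForm.evalAt_symm (hf : IsNormalForm f E R) (z : Fin 3 → Fin 2 → ℂ) :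
    evalAt f (fun k => (R k).symm (z k)) = E.symm (normalMap z) := by
  rw [LinearEquiv.eq_symm_apply, hf]
  simp

theorem IsNormalForm.noCommonFactor (hf : IsNormalForm f E R) : NoCommonFactor f := by
  intro p hp
  -- The coordinates of the factors after the coordinate changes `R k`, as polynomials.
  have hform : ∀ k, IsForm 1 fun v : Fin 3 × Fin 2 → ℂ => R k (fun j => v (k, j)) 0 := fun k =>
    (IsForm.linear (LinearMap.proj 0 ∘ₗ (R k).toLinearMap)).comp
      fun j => IsForm.coord (ι := Fin 3 × Fin 2) (k, j)
  choose q hq hqv using hform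
  have hqz : ∀ (z : Fin 3 → Fin 2 → ℂ) k,
      eval (fun v : Fin 3 × Fin 2 => (R v.1).symm (z v.1) v.2) (q k) = z k 0 := fun z k => by
    rw [hqv]
    exact congrFun ((R k).apply_symm_apply (z k)) 0
  have hq0 : ∀ k, q k ≠ 0 := fun k h => by
    have := hqz (fun _ => ![1, 0]) k
    simp [h] at this
  have hirr := fun k => irreducible_of_isHomogeneous_one (hq k) (hq0 k)
  have hcomb : ∀ r : MvPolynomial (Fin 3 × Fin 2) ℂ, r ∣ p → ∀ z : Fin 3 → Fin 2 → ℂ,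
      eval (fun v : Fin 3 × Fin 2 => (R v.1).symm (z v.1) v.2) r = 0 → normalMap z = 0 := by
    intro r hr z hz
    have h0 : evalAt f (fun k => (R k).symm (z k)) = 0 := by
      funext i
      obtain ⟨w, hw⟩ := hr.trans (hp i)
      rw [evalAt, hw, map_mul, hz, zero_mul, Pi.zero_apply]
    rw [hf.evalAt_symm] at h0
    simpa using h0
  have hprod : p ∣ q 0 * q 1 * q 2 := by
    have h1 : q 0 * q 1 * q 2 = ∑ i, C (E (Pi.single i 1) 0) * form f i := by
      refine MvPolynomial.funext fun v => ?_
      have hv : E (evalAt f fun k j => v (k, j)) 0 =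
          ∑ i, E (Pi.single i 1) 0 * evalAt f (fun k j => v (k, j)) i := by
        conv_lhs => rw [← Finset.univ_sum_single (evalAt f fun k j => v (k, j)), map_sum,
          Finset.sum_apply]
        refine Finset.sum_congr rfl fun i _ => ?_
        have : (Pi.single i (evalAt f (fun k j => v (k, j)) i) : Fin 4 → ℂ) =
            evalAt f (fun k j => v (k, j)) i • Pi.single i 1 := by
          rw [← Pi.single_smul, smul_eq_mul, mul_one]
        rw [this, map_smul, Pi.smul_apply, smul_eq_mul, mul_comm]
      rw [hf] at hv
      rw [map_mul, map_mul, hqv, hqv, hqv, map_sum]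
      simp only [map_mul, eval_C]
      exact hv
    rw [h1]
    exact Finset.dvd_sum fun i _ => (hp i).mul_left _
  by_contra hunit
  have hp0 : p ≠ 0 := by
    rintro rfl
    exact mul_ne_zero (mul_ne_zero (hq0 0) (hq0 1)) (hq0 2) (zero_dvd_iff.1 hprod)
  obtain ⟨r, hr, hrp⟩ := WfDvdMonoid.exists_irreducible_factor hunit hp0
  have key : ∀ k, r ∣ q k → q k ∣ p := fun k hk =>
    (hr.associated_of_dvd (hirr k) hk).symm.dvd.trans hrp
  rcases hr.prime.dvd_or_dvd (hrp.trans hprod) with h | h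
  · rcases hr.prime.dvd_or_dvd h with h | h
    · simpa [normalMap] using
        congrFun (hcomb _ (key 0 h) ![![0, 1], ![1, 0], ![1, 0]] (by rw [hqz]; rfl)) 1
    · simpa [normalMap] using
        congrFun (hcomb _ (key 1 h) ![![1, 0], ![0, 1], ![1, 0]] (by rw [hqz]; rfl)) 2
  · simpa [normalMap] using
      congrFun (hcomb _ (key 2 h) ![![1, 0], ![1, 0], ![0, 1]] (by rw [hqz]; rfl)) 3

/-- The pair of polynomials that is obtained from the pair `p`, `q` by the inverse of the
coordinate change `R`. -/
def pullBack (R : (Fin 2 → ℂ) ≃ₗ[ℂ] (Fin 2 → ℂ)) (p q : MvPolynomial (Fin 4) ℂ) (j : Fin 2) :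
    MvPolynomial (Fin 4) ℂ :=
  C (R.symm ![1, 0] j) * p + C (R.symm ![0, 1] j) * q

theorem eval_pullBack (R : (Fin 2 → ℂ) ≃ₗ[ℂ] (Fin 2 → ℂ)) (p q : MvPolynomial (Fin 4) ℂ)
    (x : Fin 4 → ℂ) :
    (fun j => eval x (pullBack R p q j)) = R.symm ![eval x p, eval x q] := by
  rw [eq_combination ![eval x p, eval x q], map_add, map_smul, map_smul]
  funext j
  simp [pullBack, mul_comm]

theorem isHomogeneous_pullBack {R : (Fin 2 → ℂ) ≃ₗ[ℂ] (Fin 2 → ℂ)} {p q : MvPolynomial (Fin 4) ℂ}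
    {d : ℕ} (hp : p.IsHomogeneous d) (hq : q.IsHomogeneous d) (j : Fin 2) :
    (pullBack R p q j).IsHomogeneous d :=
  (hp.C_mul _).add (hq.C_mul _)

theorem isRelPrime_pullBack {R : (Fin 2 → ℂ) ≃ₗ[ℂ] (Fin 2 → ℂ)} {p q : MvPolynomial (Fin 4) ℂ}
    (h : IsRelPrime p q) : IsRelPrime (pullBack R p q 0) (pullBack R p q 1) := by
  have key : ∀ a, C (R ![1, 0] a) * pullBack R p q 0 + C (R ![0, 1] a) * pullBack R p q 1 =
      ![p, q] a := fun a => by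
    refine MvPolynomial.funext fun x => ?_
    have h1 := congrFun (R.apply_symm_apply ![eval x p, eval x q]) a
    rw [← eval_pullBack, eq_combination fun j => eval x (pullBack R p q j), map_add, map_smul,
      map_smul] at h1
    have h2 : eval x (![p, q] a) = ![eval x p, eval x q] a := by fin_cases a <;> rfl
    rw [h2, ← h1]
    simp [mul_comm]
  intro d h0 h1
  have hd : ∀ a, d ∣ ![p, q] a := fun a => by
    rw [← key]
    exact dvd_add (h0.mul_left _) (h1.mul_left _)
  exact h (hd 0) (hd 1)

theorem IsNormalForm.isBirationalOfType (hf : IsNormalForm f E R) :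
    IsBirationalOfType f ![1, 1, 2] := by
  choose c hc hcE using isForm_coordinate E
  let ψ : Fin 3 → Fin 2 → MvPolynomial (Fin 4) ℂ := ![pullBack (R 0) (c 0) (c 1),
    pullBack (R 1) (c 0) (c 2), pullBack (R 2) (c 0 ^ 2 + c 1 * c 2) (c 0 * c 3)]
  have hψ : ∀ x k, (fun j => eval x (ψ k j)) = (R k).symm (![![E x 0, E x 1], ![E x 0, E x 2],
      ![E x 0 ^ 2 + E x 1 * E x 2, E x 0 * E x 3]] k) := by
    intro x k
    fin_cases k
    · exact (eval_pullBack _ _ _ _).trans (by simp [hcE])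
    · exact (eval_pullBack _ _ _ _).trans (by simp [hcE])
    · exact (eval_pullBack _ _ _ _).trans (by simp [hcE])
  have hndvd : ∀ (p q : MvPolynomial (Fin 4) ℂ) (x : Fin 4 → ℂ), eval (E.symm x) p = 0 →
      eval (E.symm x) q ≠ 0 → ¬ p ∣ q := by
    rintro p _ x h0 h1 ⟨r, rfl⟩
    rw [map_mul, h0, zero_mul] at h1
    exact h1 rfl
  have hcx : ∀ x i, eval (E.symm x) (c i) = x i := fun x i =>
    (hcE i _).trans (congrFun (E.apply_symm_apply x) i)
  have hc0 : ∀ i, c i ≠ 0 := fun i h => by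
    have := hcx (Pi.single i 1) i
    simp [h] at this
  have hirr := fun i => irreducible_of_isHomogeneous_one (hc i) (hc0 i)
  have hrel : ∀ i j, i ≠ j → IsRelPrime (c i) (c j) := fun i j hij =>
    (hirr i).isRelPrime_iff_not_dvd.2
      (hndvd _ _ (Pi.single j 1) (by rw [hcx, Pi.single_eq_of_ne hij]) (by rw [hcx]; simp))
  refine ⟨hf.noCommonFactor, ψ, ?_, ?_, ?_⟩
  · intro k j
    fin_cases k
    · exact isHomogeneous_pullBack (hc 0) (hc 1) j
    · exact isHomogeneous_pullBack (hc 0) (hc 2) j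
    · exact isHomogeneous_pullBack (((hc 0).pow 2).add ((hc 1).mul (hc 2)))
        ((hc 0).mul (hc 3)) j
  · intro k
    fin_cases k
    · exact isRelPrime_pullBack (hrel 0 1 (by decide))
    · exact isRelPrime_pullBack (hrel 0 2 (by decide))
    · refine isRelPrime_pullBack (IsRelPrime.mul_right ?_ ?_)
      · exact ((hirr 0).isRelPrime_iff_not_dvd.2
          (hndvd _ _ ![0, 1, 1, 0] (by simp [hcx]) (by simp [hcx]))).symm
      · exact ((hirr 3).isRelPrime_iff_not_dvd.2
          (hndvd _ _ ![1, 0, 0, 0] (by simp [hcx]) (by simp [hcx]))).symm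
  · have hleft : ∀ k, ∃ g : (Fin 3 → Fin 2 → ℂ) → ℂ, g (fun _ => ![1, 0]) ≠ 0 ∧
        ∀ y, (fun j => eval (evalAt f y) (ψ k j)) = g (fun k => R k (y k)) • y k := by
      intro k
      simp only [hψ, hf _]
      fin_cases k
      · refine ⟨fun z => z 1 0 * z 2 0, by simp, fun y => ?_⟩
        rw [LinearEquiv.symm_apply_eq, map_smul]
        funext j
        fin_cases j <;> simp [normalMap] <;> ring
      · refine ⟨fun z => z 0 0 * z 2 0, by simp, fun y => ?_⟩
        rw [LinearEquiv.symm_apply_eq, map_smul]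
        funext j
        fin_cases j <;> simp [normalMap] <;> ring
      · refine ⟨fun z => z 0 0 * z 1 0 * z 2 0 * (z 0 0 * z 1 0 + z 0 1 * z 1 1), by simp,
          fun y => ?_⟩
        rw [LinearEquiv.symm_apply_eq, map_smul]
        funext j
        fin_cases j <;> simp [normalMap] <;> ring
    have hright : ∀ x, evalAt f (fun k j => eval x (ψ k j)) =
        (E x 0 * (E x 0 ^ 2 + E x 1 * E x 2)) • x := by
      intro x
      rw [show (fun k j => eval x (ψ k j)) = _ from funext (hψ x), hf.evalAt_symm,
        LinearEquiv.symm_apply_eq, map_smul]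
      funext j
      fin_cases j <;> simp [normalMap] <;> ring
    refine ⟨fun k => ?_, fun k => ?_, ?_, fun i j => ?_⟩
    · obtain ⟨g, hg, hgy⟩ := hleft k
      by_contra hcon
      push Not at hcon
      have h1 := hgy fun k => (R k).symm ![1, 0]
      have h0 : (fun j => eval (evalAt f fun k => (R k).symm ![1, 0]) (ψ k j)) = 0 := by
        funext j
        rw [← eval_aeval_form, hcon, map_zero, Pi.zero_apply]
      rw [h0] at h1
      simp only [LinearEquiv.apply_symm_apply] at h1
      have h2 := (smul_eq_zero.1 h1.symm).resolve_left hg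
      rw [LinearEquiv.map_eq_zero_iff] at h2
      simpa using congrFun h2 0
    · obtain ⟨g, -, hgy⟩ := hleft k
      refine MvPolynomial.funext fun v => ?_
      have h1 := eval_aeval_form f (fun k j => v (k, j))
      have h2 := fun j => congrFun (hgy fun k j => v (k, j)) j
      simp only [Pi.smul_apply, smul_eq_mul] at h2
      rw [map_mul, map_mul, h1, h1, h2, h2, eval_X, eval_X]
      ring
    · by_contra hcon
      push Not at hcon
      have h1 := hright (E.symm ![1, 0, 0, 0])
      have h0 : evalAt f (fun k j => eval (E.symm ![1, 0, 0, 0]) (ψ k j)) = 0 := by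
        funext i
        rw [← eval_aeval_components, hcon, map_zero, Pi.zero_apply]
      rw [h0, E.apply_symm_apply] at h1
      have h2 := (smul_eq_zero.1 h1.symm).resolve_left (by simp)
      rw [LinearEquiv.map_eq_zero_iff] at h2
      simpa using congrFun h2 0
    · refine MvPolynomial.funext fun x => ?_
      rw [map_mul, map_mul, eval_aeval_components, eval_aeval_components, hright, eval_X, eval_X]
      simp only [Pi.smul_apply, smul_eq_mul]
      ring

/-! ### Density of the general maps -/

theorem evalAt_smul (c : ℂ) (f : Coeffs) (y : Fin 3 → Fin 2 → ℂ) :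
    evalAt (c • f) y = c • evalAt f y := by
  funext i
  simp [evalAt_apply]
  ring

theorem evalAt_add (f g : Coeffs) (y : Fin 3 → Fin 2 → ℂ) :
    evalAt (f + g) y = evalAt f y + evalAt g y := by
  funext i
  simp [evalAt_apply]
  ring

theorem IsNormalForm.smul (hf : IsNormalForm f E R) {c : ℂ} (hc : c ≠ 0) :
    IsNormalForm (c • f) ((LinearEquiv.smulOfNeZero ℂ (Fin 4 → ℂ) c⁻¹ (inv_ne_zero hc)).trans E)
      R := by
  intro y
  rw [LinearEquiv.trans_apply, evalAt_smul, LinearEquiv.smulOfNeZero_apply, smul_smul,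
    inv_mul_cancel₀ hc, one_smul, hf]

/-- The set of the trilinear maps on which some `genericity` form does not vanish. -/
def generalLocus : Set TrilinearSpace := {φ | ∃ ℓ u v, genericity ℓ u v φ.rep ≠ 0}

theorem isZariskiOpen_generalLocus : IsZariskiOpen generalLocus := by
  refine isZariskiClosed_iff.2 fun φ hφ => ?_
  rw [Set.notMem_compl_iff] at hφ
  obtain ⟨ℓ, u, v, h⟩ := hφ
  refine ⟨10, _, isForm_genericity ℓ u v, fun z hz => ?_, h⟩
  by_contra h0
  exact hz ⟨ℓ, u, v, h0⟩

variable {S T : (Fin 2 → ℂ) ≃ₗ[ℂ] (Fin 2 → ℂ)} {L : (Fin 2 → ℂ) →ₗ[ℂ] ℂ}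

theorem IsReduced.mk_mem (hf : IsReduced f E S T L) (hL : L ≠ 0) (hgen : IsGeneric f E S T L) :
    ∃ hf0 : f ≠ 0, Projectivization.mk ℂ f hf0 ∈ generalLocus ∩ Bir ![1, 1, 2] := by
  obtain ⟨ℓ, u, v, h⟩ := hf.exists_genericity_ne_zero hL hgen
  have hform := isForm_genericity ℓ u v
  have hf0 : f ≠ 0 := by
    rintro rfl
    exact h (hform.apply_zero (by norm_num))
  refine ⟨hf0, ⟨ℓ, u, v, fun h0 => h ((hform.rep_mk hf0).1 h0)⟩, ?_⟩
  obtain ⟨E', R, hNF⟩ := hf.exists_isNormalForm hgen hL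
  obtain ⟨c, hc, hcf⟩ := exists_rep_mk hf0
  change IsBirationalOfType _ _
  rw [hcf]
  exact (hNF.smul hc).isBirationalOfType

/-- The map with last component `(S s 0 * T t 0 + S s 1 * T t 1) * K u` and first three components
zero, with respect to the coordinates `E`. -/
def perturbation (E : (Fin 4 → ℂ) ≃ₗ[ℂ] (Fin 4 → ℂ)) (S T : (Fin 2 → ℂ) ≃ₗ[ℂ] (Fin 2 → ℂ))
    (K : (Fin 2 → ℂ) →ₗ[ℂ] ℂ) : Coeffs := fun ⟨i, j, k, l⟩ =>
  (S (Pi.single j 1) 0 * T (Pi.single k 1) 0 + S (Pi.single j 1) 1 * T (Pi.single k 1) 1) *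
    K (Pi.single l 1) * E.symm (Pi.single 3 1) i

theorem evalAt_perturbation (E : (Fin 4 → ℂ) ≃ₗ[ℂ] (Fin 4 → ℂ))
    (S T : (Fin 2 → ℂ) ≃ₗ[ℂ] (Fin 2 → ℂ)) (K : (Fin 2 → ℂ) →ₗ[ℂ] ℂ) (s t u : Fin 2 → ℂ) :
    E (evalAt (perturbation E S T K) ![s, t, u]) =
      ((S s 0 * T t 0 + S s 1 * T t 1) * K u) • Pi.single 3 1 := by
  have hv : ∀ v : Fin 2 → ℂ, v = v 0 • Pi.single 0 1 + v 1 • Pi.single 1 1 := fun v => by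
    funext j; fin_cases j <;> simp
  have hS : ∀ i, S s i = s 0 * S (Pi.single 0 1) i + s 1 * S (Pi.single 1 1) i := fun i => by
    conv_lhs => rw [hv s, map_add, map_smul, map_smul]
    rfl
  have hT : ∀ i, T t i = t 0 * T (Pi.single 0 1) i + t 1 * T (Pi.single 1 1) i := fun i => by
    conv_lhs => rw [hv t, map_add, map_smul, map_smul]
    rfl
  have hK : K u = u 0 * K (Pi.single 0 1) + u 1 * K (Pi.single 1 1) := by
    conv_lhs => rw [hv u, map_add, map_smul, map_smul]
    rfl
  rw [← LinearEquiv.eq_symm_apply, map_smul]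
  funext i
  simp only [evalAt_apply, perturbation, Fin.sum_univ_two, Pi.smul_apply, smul_eq_mul, hS, hT, hK,
    Matrix.cons_val]
  ring

theorem IsReduced.perturb (hf : IsReduced f E S T L) (ε : ℂ) (K : (Fin 2 → ℂ) →ₗ[ℂ] ℂ) :
    IsReduced (f + ε • perturbation E S T K) E S T L := by
  constructor <;> intro s t u <;>
    rw [evalAt_add, evalAt_smul, map_add, map_smul, evalAt_perturbation]
  · simp [hf.zero]
  · simp [hf.one]
  · simp [hf.two]

theorem lastCoeff_perturb (ε : ℂ) (K : (Fin 2 → ℂ) →ₗ[ℂ] ℂ) (a b : Fin 2) (u : Fin 2 → ℂ) :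
    lastCoeff (f + ε • perturbation E S T K) E S T a b u =
      lastCoeff f E S T a b u + ε * ((if a = b then 1 else 0) * K u) := by
  simp only [lastCoeff, LinearMap.comp_apply, uLine_apply, coordinate_apply]
  rw [evalAt_add, evalAt_smul, map_add, map_smul, evalAt_perturbation]
  fin_cases a <;> fin_cases b <;> simp

/-- All but finitely many members of a suitable pencil through a reduced map are generic. -/
theorem exists_finite_isGeneric_perturb (f : Coeffs) (E : (Fin 4 → ℂ) ≃ₗ[ℂ] (Fin 4 → ℂ))
    (S T : (Fin 2 → ℂ) ≃ₗ[ℂ] (Fin 2 → ℂ)) (L : (Fin 2 → ℂ) →ₗ[ℂ] ℂ) : ∃ K, ∃ B : Set ℂ,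
      B.Finite ∧ ∀ ε ∉ B, IsGeneric (f + ε • perturbation E S T K) E S T L := by
  obtain ⟨u, hu, hLu⟩ : ∃ u : Fin 2 → ℂ, u ≠ 0 ∧ L u = 0 := by
    obtain ⟨u, hu, hu0⟩ := (Submodule.ne_bot_iff _).1
      (LinearMap.ker_ne_bot_of_finrank_lt (f := L) (by simp))
    exact ⟨u, hu0, hu⟩
  obtain ⟨j, hj⟩ : ∃ j, u j ≠ 0 := by
    by_contra hcon
    push Not at hcon
    exact hu (funext hcon)
  let K : (Fin 2 → ℂ) →ₗ[ℂ] ℂ := (u j)⁻¹ • LinearMap.proj j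
  have hK : K u = 1 := by simp [K, hj]
  set F := fun a b => lastCoeff f E S T a b u with hF
  let P : Polynomial ℂ := Polynomial.X + Polynomial.C (F 1 1)
  let Q : Polynomial ℂ := (Polynomial.X + Polynomial.C (F 0 0)) * P - Polynomial.C (F 1 0 * F 0 1)
  have hP : P ≠ 0 := Polynomial.X_add_C_ne_zero _
  have hQ : Q ≠ 0 := by
    intro h
    -- The second difference of a monic quadratic polynomial is `2`.
    have h0 := congrArg (Polynomial.eval 0) h
    have h1 := congrArg (Polynomial.eval 1) h
    have h2 := congrArg (Polynomial.eval (-1)) h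
    simp [Q, P] at h0 h1 h2
    have : (2 : ℂ) = 0 := by linear_combination h1 + h2 - 2 * h0
    norm_num at this
  refine ⟨K, _, (Polynomial.finite_setOfPred_isRoot hP).union
    (Polynomial.finite_setOfPred_isRoot hQ), fun ε hε => ⟨u, hLu, ?_, ?_⟩⟩
  · intro h
    apply hε
    left
    rw [lastCoeff_perturb, hK] at h
    simp only [Set.mem_ofPred_eq, Polynomial.IsRoot, P, Polynomial.eval_add, Polynomial.eval_X,
      Polynomial.eval_C, hF]
    simp at h
    linear_combination h
  · intro h
    apply hε
    right
    simp only [lastCoeff_perturb, hK] at h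
    simp only [Set.mem_ofPred_eq, Polynomial.IsRoot, Q, P, Polynomial.eval_add, Polynomial.eval_X,
      Polynomial.eval_C, Polynomial.eval_mul, Polynomial.eval_sub, hF]
    simp at h
    linear_combination h

theorem Bir_subset_zariskiClosure :
    Bir ![1, 1, 2] ⊆ zariskiClosure (generalLocus ∩ Bir ![1, 1, 2]) := by
  intro φ hφ
  have hφ' : IsBirationalOfType φ.rep ![1, 1, 2] := hφ
  obtain ⟨E, S, T, L, hL, hf⟩ := hφ'.exists_isReduced
  obtain ⟨K, B, hB, hgen⟩ := exists_finite_isGeneric_perturb φ.rep E S T L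
  by_contra hcon
  obtain ⟨d, h, hh, hzero, hne⟩ := isZariskiClosed_iff.1 (isZariskiClosed_zariskiClosure _) φ hcon
  obtain ⟨P, hP⟩ := hh.exists_polynomial φ.rep (perturbation E S T K)
  have hP0 : P = 0 := by
    refine Polynomial.eq_zero_of_infinite_isRoot P (hB.infinite_compl.mono fun ε hε => ?_)
    obtain ⟨h0, hmem⟩ := (hf.perturb ε K).mk_mem hL (hgen ε hε)
    have := hzero _ (subset_zariskiClosure _ hmem)
    rw [hh.rep_mk] at this
    exact (hP ε).trans this
  have := hP 0
  rw [hP0, zero_smul, add_zero, Polynomial.eval_zero] at this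
  exact hne this.symm

/-- The coefficients of `normalMap`. -/
def normalCoeffs : Coeffs := fun ⟨i, j, k, l⟩ =>
  ![if j = 0 ∧ k = 0 ∧ l = 0 then 1 else 0, if j = 1 ∧ k = 0 ∧ l = 0 then 1 else 0,
    if j = 0 ∧ k = 1 ∧ l = 0 then 1 else 0, if j = k ∧ l = 1 then 1 else 0] i

theorem isNormalForm_normalCoeffs :
    IsNormalForm normalCoeffs (LinearEquiv.refl ℂ _) fun _ => LinearEquiv.refl ℂ _ := by
  intro y
  funext i
  rw [LinearEquiv.refl_apply, evalAt_apply]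
  fin_cases i <;> simp [normalCoeffs, normalMap, Fin.sum_univ_two]
  ring

theorem Bir_nonempty : (Bir ![1, 1, 2]).Nonempty := by
  have h0 : normalCoeffs ≠ 0 := fun h => by
    have := congrFun h (0, 0, 0, 0)
    simp [normalCoeffs] at this
  obtain ⟨c, hc, hcf⟩ := exists_rep_mk h0
  refine ⟨Projectivization.mk ℂ _ h0, ?_⟩
  change IsBirationalOfType _ _
  rw [hcf]
  exact (isNormalForm_normalCoeffs.smul hc).isBirationalOfType

theorem generalLocus_inter_Bir_nonempty : (generalLocus ∩ Bir ![1, 1, 2]).Nonempty := by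
  rw [Set.nonempty_iff_ne_empty]
  intro h
  obtain ⟨φ, hφ⟩ := Bir_nonempty
  have := Bir_subset_zariskiClosure hφ
  rw [h] at this
  exact this ∅ ⟨isZariskiClosed_empty, subset_rfl⟩

theorem exists_isNormalForm_of_mem_generalLocus {φ : TrilinearSpace}
    (hφ : φ ∈ generalLocus ∩ Bir ![1, 1, 2]) : ∃ E R, IsNormalForm φ.rep E R := by
  obtain ⟨⟨ℓ, u, v, hne⟩, hbir⟩ := hφ
  have hbir' : IsBirationalOfType φ.rep ![1, 1, 2] := hbir
  obtain ⟨E, S, T, L, hL, hf⟩ := hbir'.exists_isReduced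
  exact hf.exists_isNormalForm (hf.isGeneric_of_genericity_ne_zero hne) hL

end

end TrilinearCongruence

end

theorem propositionC :
    ∃ G : Set TrilinearCongruence.TrilinearSpace,
      TrilinearCongruence.IsZariskiOpen G ∧
      (G ∩ TrilinearCongruence.Bir ![1, 1, 2]).Nonempty ∧
      TrilinearCongruence.Bir ![1, 1, 2] ⊆
        TrilinearCongruence.zariskiClosure (G ∩ TrilinearCongruence.Bir ![1, 1, 2]) ∧
      ∀ φ ∈ G ∩ TrilinearCongruence.Bir ![1, 1, 2],
        ∃ a b c : Set TrilinearCongruence.P3,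
          TrilinearCongruence.IsLine a ∧ TrilinearCongruence.IsLine b ∧ a ≠ b ∧
          TrilinearCongruence.IsPlaneConic c ∧
          (∃ H, TrilinearCongruence.IsPlane H ∧ a ⊆ H ∧ b ⊆ H) ∧
          (∃ P, a ∩ c = {P}) ∧
          (∃ Q, b ∩ c = {Q}) ∧
          (TrilinearCongruence.IsQuadratic (TrilinearCongruence.parametricCongruence φ 0) ∧
            TrilinearCongruence.focalCurves
              (TrilinearCongruence.parametricCongruence φ 0) = {a, c}) ∧
          (TrilinearCongruence.IsQuadratic (TrilinearCongruence.parametricCongruence φ 1) ∧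
            TrilinearCongruence.focalCurves
              (TrilinearCongruence.parametricCongruence φ 1) = {b, c}) ∧
          (TrilinearCongruence.IsDegenerate (TrilinearCongruence.parametricCongruence φ 2) ∧
            ∃ O, a ∩ b = {O} ∧
              TrilinearCongruence.focalPoints
                (TrilinearCongruence.parametricCongruence φ 2) = {O}) := by
  refine ⟨TrilinearCongruence.generalLocus, TrilinearCongruence.isZariskiOpen_generalLocus,
    TrilinearCongruence.generalLocus_inter_Bir_nonempty,
    TrilinearCongruence.Bir_subset_zariskiClosure, fun φ hφ => ?_⟩
  obtain ⟨E, R, hf⟩ := TrilinearCongruence.exists_isNormalForm_of_mem_generalLocus hφ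
  exact hf.congruences
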